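/- A $k$-point permutation is a bijection $\sigma:[k]\to[k]$, written $\sigma(1)\cdots\sigma(k)$. For a $k$-point permutation $\sigma$ and an $n$-point permutation $\pi$, the density $d(\sigma,\pi)$ is the proportion of the $k$-element sets $\{a_1<\dots<a_k\}\subseteq[n]$ for which $\sigma(i)<\sigma(j)\iff\pi(a_i)<\pi(a_j)$ for all $i,j\in[k]$ (and $d(\sigma,\pi)=0$ if $k>n$). A sequence $(\pi_n)_{n\in\mathbb N}$ of permutations whose sizes tend to infinity is quasirandom if $d(\sigma,\pi_n)\to 1/|\sigma|!$ for every permutation $\sigma$. A set $Z$ of permutations is quasirandom-forcing if every sequence $(\pi_n)$ of permutations whose sizes tend to infinity is quasirandom if and only if $d(\sigma,\pi_n)\to 1/|\sigma|!$ for every $\sigma\in Z$. A permuton is a Borel probability measure $\mu$ on $[0,1]^2$ both of whose marginals are uniform on $[0,1]$; $d(\sigma,\mu)$ is the probability that $|\sigma|$ independent $\mu$-random points, listed as $(x_1,y_1),\dots,(x_k,y_k)$ with $x_1<\dots<x_k$, satisfy $\sigma(i)<\sigma(j)\iff y_i<y_j$ for all $i,j$. For a doubly stochastic $k\times k$ matrix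 $A$, $\mu[A]$ is the (step) permuton $$\mu[A](X)=k\sum_{i,j\in[k]}A_{ij}\,\lambda\Bigl(X\cap\bigl[\tfrac{i-1}{k},\tfrac ik\bigr)\times\bigl[\tfrac{j-1}{k},\tfrac jk\bigr)\Bigr),$$ where $\lambda$ is the uniform measure on $[0,1]^2$. The permutation matrix $A_\pi$ has entry $1$ at the positions $(i,\pi(i))$ and $0$ elsewhere. Let $$\begin{aligned}\pi_1&=31,1,29,3,27,5,25,7,23,9,21,11,19,13,17,15,18,16,20,14,22,12,24,10,26,8,28,6,30,4,32,2,\\ \pi_2&=17,15,19,13,21,11,23,9,25,7,27,5,29,3,31,1,32,2,30,4,28,6,26,8,24,10,22,12,20,14,18,16,\\ \pi_3&=12,27,13,26,10,2,4,16,15,28,14,32,30,22,24,25,8,9,11,3,1,19,5,18,17,29,31,23,7,20,6,21.\end{aligned}$$ **Theorem.** The set $\{1234,2143,3412,4321\}$ is not quasirandom-forcing. Moreover, there exist reals $x,y,z\ge 0$ with $x+y+z=1$ such that the matrix $A=xA_{\pi_1}+yA_{\pi_2}+zA_{\pi_3}$ is doubly stochastic, $\mu[A]$ is a permuton different from the uniform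 measure $\lambda$, and $$d(1234,\mu[A])=d(2143,\mu[A])=d(3412,\mu[A])=d(4321,\mu[A])=\tfrac1{24}.$$ -/

import Mathlib

open MeasureTheory Filter Topology
open scoped ENNReal

namespace PermQuasi

/-- The `k`-point permutation with one-line notation `w 0, …, w (k-1)` (a listing of `1, …, k`).
Points and values are indexed from `0` in `Fin k`, hence the shift by one. -/
noncomputable def oneLine {k : ℕ} (w : Fin k → ℕ) (hw : ∀ i, 1 ≤ w i ∧ w i ≤ k)
    (hinj : Function.Injective w) : Equiv.Perm (Fin k) :=
  Equiv.ofBijective (fun i => (⟨w i - 1, by have := hw i; omega⟩ : Fin k))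
    (Finite.injective_iff_bijective.mp (by
      intro i j h
      have h1 := hw i
      have h2 := hw j
      have h3 : w i - 1 = w j - 1 := congrArg Fin.val h
      exact hinj (by omega)))

/-- `σ` is the subpermutation of `π` induced by the set `A` of points:
`|A| = k` and, for the increasing enumeration `a` of `A`, `σ i < σ j ↔ π (a i) < π (a j)`. -/
def IsInducedBy {k n : ℕ} (σ : Equiv.Perm (Fin k)) (π : Equiv.Perm (Fin n))
    (A : Finset (Fin n)) : Prop :=
  ∃ h : A.card = k, ∀ i j : Fin k,
    σ i < σ j ↔ π (A.orderEmbOfFin h i) < π (A.orderEmbOfFin h j)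

open Classical in
/-- The (pattern) density `d(σ, π)`: the proportion of the `k`-element subsets of the points of `π`
that induce `σ`. It is `0` if `k > n`, since then both the numerator and `n.choose k` vanish. -/
noncomputable def density {k n : ℕ} (σ : Equiv.Perm (Fin k)) (π : Equiv.Perm (Fin n)) : ℝ :=
  (((Finset.univ : Finset (Fin n)).powersetCard k).filter fun A => IsInducedBy σ π A).card /
    (n.choose k : ℝ)

/-- A sequence of permutations is quasirandom if, for every permutation `σ`, the density of `σ`
in it converges to `1 / |σ|!`. -/
def IsQuasirandom (π : ℕ → Σ n : ℕ, Equiv.Perm (Fin n)) : Prop :=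
  ∀ (k : ℕ) (σ : Equiv.Perm (Fin k)),
    Tendsto (fun i => density σ (π i).2) atTop (𝓝 (1 / (k.factorial : ℝ)))

/-- A set `Z` of permutations is quasirandom-forcing if a sequence of permutations whose sizes
tend to infinity is quasirandom if and only if the density of each `σ ∈ Z` converges to its
expected density `1 / |σ|!` in a random permutation. -/
def IsQuasirandomForcing (Z : Set (Σ k : ℕ, Equiv.Perm (Fin k))) : Prop :=
  ∀ π : ℕ → Σ n : ℕ, Equiv.Perm (Fin n), Tendsto (fun i => (π i).1) atTop atTop →
    (IsQuasirandom π ↔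
      ∀ σ ∈ Z, Tendsto (fun i => density σ.2 (π i).2) atTop (𝓝 (1 / (σ.1.factorial : ℝ))))

/-- A permuton: a Borel probability measure on `[0,1]²` with uniform marginals. -/
structure IsPermuton (μ : Measure (unitInterval × unitInterval)) : Prop where
  isProbabilityMeasure : IsProbabilityMeasure μ
  map_fst : μ.map Prod.fst = volume
  map_snd : μ.map Prod.snd = volume

/-- `k` points `p` of `[0,1]²`, once listed (by `τ`) with increasing first coordinates, have the
pattern `σ`. -/
def HasPattern {k : ℕ} (σ : Equiv.Perm (Fin k)) (p : Fin k → unitInterval × unitInterval) : Prop :=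
  ∃ τ : Equiv.Perm (Fin k), StrictMono (fun i => (p (τ i)).1) ∧
    ∀ i j, σ i < σ j ↔ (p (τ i)).2 < (p (τ j)).2

/-- The density `d(σ, μ)`: the probability that `k` independent `μ`-random points have
pattern `σ`. -/
noncomputable def permutonDensity {k : ℕ} (σ : Equiv.Perm (Fin k)) (μ : Measure (unitInterval × unitInterval)) : ℝ :=
  (Measure.pi fun _ : Fin k => μ).real {p | HasPattern σ p}

/-- The cell `[i/k, (i+1)/k) × [j/k, (j+1)/k)` of the `k × k` grid, `i, j ∈ {0, …, k-1}`. -/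
def cell {k : ℕ} (i j : Fin k) : Set (unitInterval × unitInterval) :=
  {p | (p.1 : ℝ) ∈ Set.Ico ((i : ℝ) / k) (((i : ℝ) + 1) / k) ∧
    (p.2 : ℝ) ∈ Set.Ico ((j : ℝ) / k) (((j : ℝ) + 1) / k)}

/-- The measure `μ[A](X) = k ∑ i j, A i j * λ(X ∩ cell i j)`, with `λ` the uniform measure on
`[0,1]²`. It is used for matrices `A` with non-negative entries. -/
noncomputable def stepMeasure {k : ℕ} (A : Matrix (Fin k) (Fin k) ℝ) : Measure (unitInterval × unitInterval) :=
  (k : ℝ≥0∞) • ∑ i, ∑ j, ENNReal.ofReal (A i j) • (volume : Measure (unitInterval × unitInterval)).restrict (cell i j)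

/-- The permutations `1234`, `2143`, `3412`, `4321`. -/
noncomputable def p1234 : Equiv.Perm (Fin 4) := oneLine ![1, 2, 3, 4] (by decide) (by decide)
noncomputable def p2143 : Equiv.Perm (Fin 4) := oneLine ![2, 1, 4, 3] (by decide) (by decide)
noncomputable def p3412 : Equiv.Perm (Fin 4) := oneLine ![3, 4, 1, 2] (by decide) (by decide)
noncomputable def p4321 : Equiv.Perm (Fin 4) := oneLine ![4, 3, 2, 1] (by decide) (by decide)

set_option maxRecDepth 20000 in
/-- The first of the three `32`-point permutations. -/
noncomputable def pi1 : Equiv.Perm (Fin 32) :=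
  oneLine ![31, 1, 29, 3, 27, 5, 25, 7, 23, 9, 21, 11, 19, 13, 17, 15,
    18, 16, 20, 14, 22, 12, 24, 10, 26, 8, 28, 6, 30, 4, 32, 2] (by decide) (by decide)

set_option maxRecDepth 20000 in
/-- The second of the three `32`-point permutations. -/
noncomputable def pi2 : Equiv.Perm (Fin 32) :=
  oneLine ![17, 15, 19, 13, 21, 11, 23, 9, 25, 7, 27, 5, 29, 3, 31, 1,
    32, 2, 30, 4, 28, 6, 26, 8, 24, 10, 22, 12, 20, 14, 18, 16] (by decide) (by decide)

set_option maxRecDepth 20000 in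
/-- The third of the three `32`-point permutations. -/
noncomputable def pi3 : Equiv.Perm (Fin 32) :=
  oneLine ![12, 27, 13, 26, 10, 2, 4, 16, 15, 28, 14, 32, 30, 22, 24, 25,
    8, 9, 11, 3, 1, 19, 5, 18, 17, 29, 31, 23, 7, 20, 6, 21] (by decide) (by decide)

/-- The matrix `x A_{π₁} + y A_{π₂} + z A_{π₃}`, where the permutation matrix `A_π` has entry `1`
at the positions `(i, π i)` and `0` elsewhere. -/
noncomputable def mixMatrix (x y z : ℝ) : Matrix (Fin 32) (Fin 32) ℝ :=
  x • pi1.permMatrix ℝ + y • pi2.permMatrix ℝ + z • pi3.permMatrix ℝ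

end PermQuasi

namespace PermQuasi

/-! The density of a $k$-point pattern in a step permuton $\mu[A]$ is a polynomial in the entries of
$A$: choose a cell for each point, and weight the choice by the probability that uniform points in
the chosen rows and columns come in the right order (`permutonDensity_stepMeasure`). For
$A=xA_{\pi_1}+yA_{\pi_2}+zA_{\pi_3}$ it is a form of degree $k$ in $x,y,z$.

Each $\pi_c$ satisfies $\pi_c\circ\pi_c=\mathrm{rev}$, so $A$ is invariant under a quarter turn.
That turn exchanges 1234 with 4321 and 2143 with 3412 (`chainSum_rotate`), so only two equations
remain on the two-dimensional simplex $x+y+z=1$. The two quartic forms are computed exactly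
(`form1234`, `form2143`), and a planar intermediate value argument (`exists_common_root`) gives a
common solution in a small square near $(x,y)=(0.08,0.055)$.

On that whole square the density of 123 exceeds $1/6$ (`form123`, `gap_q123_pos`), so the solution
need not be known explicitly. Permutations sampled from $\mu[A]$ have pattern densities concentrated
around those of $\mu[A]$ (`exists_tendsto_density`); they thus meet the four conditions in the limit
without being quasirandom.

The coefficients come from Kronecker substitution: a single natural number, the value of the form at
$(1,B,B^{k+1})$ with $B=2^{32}$, has them as its base-$B$ digits. The kernel evaluates it through
prefix and suffix sums of $32\times32$ tables, not as an eightfold sum. -/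

/-! ### Weighted prefix and suffix sums of tables -/

/-- The weight `p` on `i < j`, the weight `q` on `i = j`, and `0` on `i > j`. -/
def kern (w : ℕ × ℕ) (i j : ℕ) : ℕ := if i < j then w.1 else if i = j then w.2 else 0

/-- Contraction of a row with `kern`: entries strictly before the current one get weight `w.1`, the
current one `w.2`, and the accumulator carries the running prefix sum. `rowSuf`, `colPre` and
`colSuf` treat the other three directions. -/
def rowPre (w : ℕ × ℕ) : ℕ → List ℕ → List ℕ
  | _, [] => []
  | s, x :: l => (w.1 * s + w.2 * x) :: rowPre w (s + x) l

def rowSuf (w : ℕ × ℕ) : List ℕ → List ℕ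
  | [] => []
  | x :: l => (w.1 * l.sum + w.2 * x) :: rowSuf w l

def colPre (w : ℕ × ℕ) : List ℕ → List (List ℕ) → List (List ℕ)
  | _, [] => []
  | s, r :: L =>
    List.zipWith (fun u v => w.1 * u + w.2 * v) s r :: colPre w (List.zipWith (· + ·) s r) L

def sumRows (n : ℕ) : List (List ℕ) → List ℕ
  | [] => List.replicate n 0
  | r :: L => List.zipWith (· + ·) r (sumRows n L)

def colSuf (w : ℕ × ℕ) (n : ℕ) : List (List ℕ) → List (List ℕ)
  | [] => []
  | r :: L => List.zipWith (fun u v => w.1 * u + w.2 * v) (sumRows n L) r :: colSuf w n L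

def tabMul : List (List ℕ) → List (List ℕ) → List (List ℕ) :=
  List.zipWith (List.zipWith (· * ·))

def tabSum (L : List (List ℕ)) : ℕ := (L.map List.sum).sum

/-- The `n × n` table of the values of `f`. -/
def tab (n : ℕ) (f : ℕ → ℕ → ℕ) : List (List ℕ) :=
  (List.range n).map fun a => (List.range n).map (f a)

theorem zipWith_map_map {α β γ δ : Type*} (g : α → β → γ) (l : List δ) (u : δ → α) (v : δ → β) :
    List.zipWith g (l.map u) (l.map v) = l.map fun a => g (u a) (v a) := by
  induction l with
  | nil => rfl
  | cons a l ih => simp [ih]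

theorem sum_map_range' (s n : ℕ) (f : ℕ → ℕ) :
    ((List.range' s n).map f).sum = ∑ i ∈ Finset.Ico s (s + n), f i := by
  induction n generalizing s with
  | zero => simp
  | succ n ih =>
    rw [List.range'_succ, List.map_cons, List.sum_cons, ih,
      Finset.sum_eq_sum_Ico_succ_bot (by omega : s < s + (n + 1))]
    congr 3; omega

theorem sum_map_range (n : ℕ) (f : ℕ → ℕ) :
    ((List.range n).map f).sum = ∑ i ∈ Finset.range n, f i := by
  rw [List.range_eq_range', sum_map_range', zero_add, Finset.range_eq_Ico]

theorem sum_kern_left (w : ℕ × ℕ) (n b : ℕ) (hb : b < n) (f : ℕ → ℕ) :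
    ∑ j ∈ Finset.range n, kern w j b * f j = w.1 * (∑ j ∈ Finset.Ico 0 b, f j) + w.2 * f b := by
  have h1 : ∀ j, kern w j b * f j =
      (if j < b then w.1 * f j else 0) + if b = j then w.2 * f j else 0 := by
    intro j; unfold kern; split_ifs <;> omega
  have h2 : (Finset.range n).filter (fun j => j < b) = Finset.Ico 0 b := by
    ext j; simp; omega
  simp_rw [h1]
  rw [Finset.sum_add_distrib, Finset.sum_ite_eq, ← Finset.sum_filter, h2, Finset.mul_sum]
  simp [hb]

theorem sum_kern_right (w : ℕ × ℕ) (n b : ℕ) (hb : b < n) (f : ℕ → ℕ) :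
    ∑ j ∈ Finset.range n, kern w b j * f j =
      w.1 * (∑ j ∈ Finset.Ico (b + 1) n, f j) + w.2 * f b := by
  have h1 : ∀ j, kern w b j * f j =
      (if b < j then w.1 * f j else 0) + if b = j then w.2 * f j else 0 := by
    intro j; unfold kern; split_ifs <;> omega
  have h2 : (Finset.range n).filter (fun j => b < j) = Finset.Ico (b + 1) n := by
    ext j; simp; omega
  simp_rw [h1]
  rw [Finset.sum_add_distrib, Finset.sum_ite_eq, ← Finset.sum_filter, h2, Finset.mul_sum]
  simp [hb]

theorem rowPre_map (w : ℕ × ℕ) (f : ℕ → ℕ) (c s n : ℕ) :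
    rowPre w c ((List.range' s n).map f) =
      (List.range' s n).map fun b => w.1 * (c + ∑ j ∈ Finset.Ico s b, f j) + w.2 * f b := by
  induction n generalizing s c with
  | zero => rfl
  | succ n ih =>
    rw [List.range'_succ, List.map_cons, rowPre, ih, List.map_cons]
    congr 1
    · simp
    · refine List.map_congr_left fun b hb => ?_
      rw [List.mem_range'_1] at hb
      rw [Finset.sum_eq_sum_Ico_succ_bot (by omega : s < b), add_assoc]

theorem rowSuf_map (w : ℕ × ℕ) (f : ℕ → ℕ) (s n : ℕ) :
    rowSuf w ((List.range' s n).map f) =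
      (List.range' s n).map fun b =>
        w.1 * (∑ j ∈ Finset.Ico (b + 1) (s + n), f j) + w.2 * f b := by
  induction n generalizing s with
  | zero => rfl
  | succ n ih =>
    rw [List.range'_succ, List.map_cons, rowSuf, ih, List.map_cons, sum_map_range']
    congr 1
    · congr 4; omega
    · refine List.map_congr_left fun b _ => ?_
      congr 4; omega

theorem colPre_map (w : ℕ × ℕ) (l : List ℕ) (f : ℕ → ℕ → ℕ) (c : ℕ → ℕ) (s n : ℕ) :
    colPre w (l.map c) ((List.range' s n).map fun a => l.map (f a)) =
      (List.range' s n).map fun a => l.map fun b =>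
        w.1 * (c b + ∑ i ∈ Finset.Ico s a, f i b) + w.2 * f a b := by
  induction n generalizing s c with
  | zero => rfl
  | succ n ih =>
    rw [List.range'_succ, List.map_cons, colPre, zipWith_map_map, zipWith_map_map, ih,
      List.map_cons]
    congr 1
    · simp
    · refine List.map_congr_left fun a ha => ?_
      rw [List.mem_range'_1] at ha
      refine List.map_congr_left fun b _ => ?_
      rw [Finset.sum_eq_sum_Ico_succ_bot (by omega : s < a), add_assoc]

theorem sumRows_map (m : ℕ) (f : ℕ → ℕ → ℕ) (s n : ℕ) :
    sumRows m ((List.range' s n).map fun a => (List.range m).map (f a)) =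
      (List.range m).map fun b => ∑ i ∈ Finset.Ico s (s + n), f i b := by
  induction n generalizing s with
  | zero => simp [sumRows, List.map_const']
  | succ n ih =>
    rw [List.range'_succ, List.map_cons, sumRows, ih, zipWith_map_map]
    refine List.map_congr_left fun b _ => ?_
    rw [Finset.sum_eq_sum_Ico_succ_bot (by omega : s < s + (n + 1))]
    congr 3; omega

theorem colSuf_map (w : ℕ × ℕ) (m : ℕ) (f : ℕ → ℕ → ℕ) (s n : ℕ) :
    colSuf w m ((List.range' s n).map fun a => (List.range m).map (f a)) =
      (List.range' s n).map fun a => (List.range m).map fun b =>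
        w.1 * (∑ i ∈ Finset.Ico (a + 1) (s + n), f i b) + w.2 * f a b := by
  induction n generalizing s with
  | zero => rfl
  | succ n ih =>
    rw [List.range'_succ, List.map_cons, colSuf, sumRows_map, zipWith_map_map, ih, List.map_cons]
    congr 1
    · refine List.map_congr_left fun b _ => ?_
      congr 4; omega
    · refine List.map_congr_left fun a _ => List.map_congr_left fun b _ => ?_
      congr 4; omega

theorem tab_congr {n : ℕ} {f g : ℕ → ℕ → ℕ} (h : ∀ a < n, ∀ b < n, f a b = g a b) :
    tab n f = tab n g := by
  refine List.map_congr_left fun a ha => List.map_congr_left fun b hb => ?_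
  exact h a (List.mem_range.mp ha) b (List.mem_range.mp hb)

theorem tabMul_tab (n : ℕ) (f g : ℕ → ℕ → ℕ) :
    tabMul (tab n f) (tab n g) = tab n fun a b => f a b * g a b := by
  unfold tabMul tab
  rw [zipWith_map_map]
  exact List.map_congr_left fun a _ => zipWith_map_map _ _ _ _

theorem tabSum_tab (n : ℕ) (f : ℕ → ℕ → ℕ) :
    tabSum (tab n f) = ∑ a ∈ Finset.range n, ∑ b ∈ Finset.range n, f a b := by
  unfold tabSum tab
  rw [List.map_map, sum_map_range]
  exact Finset.sum_congr rfl fun a _ => sum_map_range _ _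

theorem map_rowPre_tab (w : ℕ × ℕ) (n : ℕ) (f : ℕ → ℕ → ℕ) :
    (tab n f).map (rowPre w 0) =
      tab n fun a b => ∑ j ∈ Finset.range n, kern w j b * f a j := by
  unfold tab
  rw [List.map_map]
  refine List.map_congr_left fun a _ => ?_
  rw [Function.comp_apply, List.range_eq_range', rowPre_map]
  refine List.map_congr_left fun b hb => ?_
  rw [zero_add]
  exact (sum_kern_left w n b (by simpa using hb) _).symm

theorem map_rowSuf_tab (w : ℕ × ℕ) (n : ℕ) (f : ℕ → ℕ → ℕ) :
    (tab n f).map (rowSuf w) =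
      tab n fun a b => ∑ j ∈ Finset.range n, kern w b j * f a j := by
  unfold tab
  rw [List.map_map]
  refine List.map_congr_left fun a _ => ?_
  rw [Function.comp_apply, List.range_eq_range', rowSuf_map]
  refine List.map_congr_left fun b hb => ?_
  rw [zero_add]
  exact (sum_kern_right w n b (by simpa using hb) _).symm

theorem colPre_tab (w : ℕ × ℕ) (n : ℕ) (f : ℕ → ℕ → ℕ) :
    colPre w (List.replicate n 0) (tab n f) =
      tab n fun a b => ∑ i ∈ Finset.range n, kern w i a * f i b := by
  have h := colPre_map w (List.range n) f (fun _ => 0) 0 n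
  rw [List.map_const', List.length_range, ← List.range_eq_range'] at h
  unfold tab
  rw [h]
  refine List.map_congr_left fun a ha => List.map_congr_left fun b _ => ?_
  rw [zero_add]
  exact (sum_kern_left w n a (by simpa using ha) (fun i => f i b)).symm

theorem colSuf_tab (w : ℕ × ℕ) (n : ℕ) (f : ℕ → ℕ → ℕ) :
    colSuf w n (tab n f) =
      tab n fun a b => ∑ i ∈ Finset.range n, kern w a i * f i b := by
  have h := colSuf_map w n f 0 n
  rw [← List.range_eq_range'] at h
  unfold tab
  rw [h]
  refine List.map_congr_left fun a ha => List.map_congr_left fun b _ => ?_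
  rw [zero_add]
  exact (sum_kern_right w n a (by simpa using ha) (fun i => f i b)).symm

/-! ### Sums over chains of four, or of three, points of the grid -/

/-- The terms `u (i₁, i₂) * v (i₂, i₃) * w (i₃, i₄)` of a decomposition of a weight of chains. -/
abbrev ChainTerm := (ℕ × ℕ) × (ℕ × ℕ) × (ℕ × ℕ)

/-- `24` times the probability that four uniform points of the cells `i₁, …, i₄` increase, as a sum
of three products. -/
def chainTerms : List ChainTerm :=
  [((2, 1), (1, 0), (12, 6)), ((12, 4), (0, 1), (1, 0)), ((4, 1), (0, 1), (0, 1))]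

/-- The three terms cover the disjoint cases $i_2<i_3$, $i_2=i_3<i_4$ and $i_2=i_3=i_4$. Within each
case, 24 divided by the product of the factorials of the block sizes splits into factors of
consecutive pairs, as the table contractions require. -/
def chainWeight (i₁ i₂ i₃ i₄ : ℕ) : ℕ :=
  (chainTerms.map fun m => kern m.1 i₁ i₂ * kern m.2.1 i₂ i₃ * kern m.2.2 i₃ i₄).sum

/-- The same for three points, with the factor `6`. -/
def chainTerms₃ : List ((ℕ × ℕ) × (ℕ × ℕ)) := [((6, 3), (1, 0)), ((3, 1), (0, 1))]

def chainWeight₃ (i₁ i₂ i₃ : ℕ) : ℕ :=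
  (chainTerms₃.map fun m => kern m.1 i₁ i₂ * kern m.2 i₂ i₃).sum

/-- `C` has the first row and column index of the chain already summed out, `D` the last ones. The
middle kernels join the two halves, once for each of the nine pairs of terms. -/
def tabVal (n : ℕ) (C D : (ℕ × ℕ) → (ℕ × ℕ) → List (List ℕ)) : ℕ :=
  (chainTerms.map fun m => (chainTerms.map fun m' =>
    tabSum (tabMul (D m.2.2 m'.2.2)
      (colPre m.2.1 (List.replicate n 0) ((C m.1 m'.1).map (rowPre m'.2.1 0))))).sum).sum

def val1234 (n : ℕ) (L : List (List ℕ)) : ℕ :=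
  tabVal n (fun u u' => tabMul L (colPre u (List.replicate n 0) (L.map (rowPre u' 0))))
    (fun u u' => tabMul L (colSuf u n (L.map (rowSuf u'))))

/-- Like 1234, the pattern 2143 maps its first two positions to its two lowest values, so the sum
splits into two halves. In each half the crossed product $A_{i_1j_2}A_{i_2j_1}$ separates into a
column sum times a row sum. -/
def val2143 (n : ℕ) (L : List (List ℕ)) : ℕ :=
  tabVal n (fun u u' => tabMul (colPre u (List.replicate n 0) L) (L.map (rowPre u' 0)))
    (fun u u' => tabMul (colSuf u n L) (L.map (rowSuf u')))

def val123 (n : ℕ) (L : List (List ℕ)) : ℕ :=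
  (chainTerms₃.map fun m => (chainTerms₃.map fun m' =>
    tabSum (tabMul L (tabMul (colPre m.1 (List.replicate n 0) (L.map (rowPre m'.1 0)))
      (colSuf m.2 n (L.map (rowSuf m'.2)))))).sum).sum

/-- The two halves of the chains communicate only through $r_2$ and $s_2$, so distributivity turns
the eightfold sum into successive contractions. -/
theorem sum_chain_factor (s : Finset ℕ) (r₁ r₂ r₃ s₁ s₂ s₃ : ℕ → ℕ → ℕ)
    (P Q : ℕ → ℕ → ℕ → ℕ → ℕ) :
    ∑ i₁ ∈ s, ∑ i₂ ∈ s, ∑ i₃ ∈ s, ∑ i₄ ∈ s, ∑ j₁ ∈ s, ∑ j₂ ∈ s, ∑ j₃ ∈ s, ∑ j₄ ∈ s,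
      (r₁ i₁ i₂ * r₂ i₂ i₃ * r₃ i₃ i₄) * (s₁ j₁ j₂ * s₂ j₂ j₃ * s₃ j₃ j₄) *
        (P i₁ i₂ j₁ j₂ * Q i₃ i₄ j₃ j₄) =
    ∑ i₃ ∈ s, ∑ j₃ ∈ s, (∑ i₄ ∈ s, ∑ j₄ ∈ s, r₃ i₃ i₄ * s₃ j₃ j₄ * Q i₃ i₄ j₃ j₄) *
      ∑ i₂ ∈ s, r₂ i₂ i₃ * ∑ j₂ ∈ s, s₂ j₂ j₃ *
        ∑ i₁ ∈ s, ∑ j₁ ∈ s, r₁ i₁ i₂ * s₁ j₁ j₂ * P i₁ i₂ j₁ j₂ := by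
  simp only [Finset.mul_sum, Finset.sum_mul, ← Finset.sum_product']
  refine Finset.sum_nbij'
    (fun ⟨i₁, i₂, i₃, i₄, j₁, j₂, j₃, j₄⟩ => ⟨i₃, j₃, ⟨i₂, j₂, i₁, j₁⟩, i₄, j₄⟩)
    (fun ⟨i₃, j₃, ⟨i₂, j₂, i₁, j₁⟩, i₄, j₄⟩ => ⟨i₁, i₂, i₃, i₄, j₁, j₂, j₃, j₄⟩) ?_ ?_ ?_ ?_ ?_
  · rintro ⟨i₁, i₂, i₃, i₄, j₁, j₂, j₃, j₄⟩ h
    simp only [Finset.mem_product] at h ⊢; tauto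
  · rintro ⟨i₃, j₃, ⟨i₂, j₂, i₁, j₁⟩, i₄, j₄⟩ h
    simp only [Finset.mem_product] at h ⊢; tauto
  · rintro ⟨i₁, i₂, i₃, i₄, j₁, j₂, j₃, j₄⟩ _; rfl
  · rintro ⟨i₃, j₃, ⟨i₂, j₂, i₁, j₁⟩, i₄, j₄⟩ _; rfl
  · rintro ⟨i₁, i₂, i₃, i₄, j₁, j₂, j₃, j₄⟩ _
    ring

theorem sum_list_map_sum {ι α : Type*} (s : Finset ι) (l : List α) (f : ι → α → ℕ) :
    ∑ i ∈ s, (l.map (f i)).sum = (l.map fun m => ∑ i ∈ s, f i m).sum := by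
  induction l with
  | nil => simp
  | cons a l ih => simp [Finset.sum_add_distrib, ih]

theorem tabVal_tab (n : ℕ) (P Q : ℕ → ℕ → ℕ → ℕ → ℕ)
    (C D : (ℕ × ℕ) → (ℕ × ℕ) → List (List ℕ))
    (hC : ∀ u u', C u u' = tab n fun a b => ∑ i ∈ Finset.range n, ∑ j ∈ Finset.range n,
      kern u i a * kern u' j b * P i a j b)
    (hD : ∀ u u', D u u' = tab n fun a b => ∑ i ∈ Finset.range n, ∑ j ∈ Finset.range n,
      kern u a i * kern u' b j * Q a i b j) :
    tabVal n C D =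
      ∑ i₁ ∈ Finset.range n, ∑ i₂ ∈ Finset.range n, ∑ i₃ ∈ Finset.range n, ∑ i₄ ∈ Finset.range n,
      ∑ j₁ ∈ Finset.range n, ∑ j₂ ∈ Finset.range n, ∑ j₃ ∈ Finset.range n, ∑ j₄ ∈ Finset.range n,
        chainWeight i₁ i₂ i₃ i₄ * chainWeight j₁ j₂ j₃ j₄ *
          (P i₁ i₂ j₁ j₂ * Q i₃ i₄ j₃ j₄) := by
  have h : ∀ i₁ i₂ i₃ i₄ j₁ j₂ j₃ j₄ x : ℕ, chainWeight i₁ i₂ i₃ i₄ * chainWeight j₁ j₂ j₃ j₄ * x =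
      (chainTerms.map fun m => (chainTerms.map fun m' =>
        kern m.1 i₁ i₂ * kern m.2.1 i₂ i₃ * kern m.2.2 i₃ i₄ *
          (kern m'.1 j₁ j₂ * kern m'.2.1 j₂ j₃ * kern m'.2.2 j₃ j₄) * x).sum).sum := by
    intros
    simp only [chainWeight, ← List.sum_map_mul_right]
    simp only [← List.sum_map_mul_left]
    simp only [← List.sum_map_mul_right]
  simp only [h, sum_list_map_sum]
  simp only [tabVal, hC, hD, map_rowPre_tab, colPre_tab, tabMul_tab, tabSum_tab, sum_chain_factor]

theorem val1234_tab (n : ℕ) (A : ℕ → ℕ → ℕ) :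
    val1234 n (tab n A) =
      ∑ i₁ ∈ Finset.range n, ∑ i₂ ∈ Finset.range n, ∑ i₃ ∈ Finset.range n, ∑ i₄ ∈ Finset.range n,
      ∑ j₁ ∈ Finset.range n, ∑ j₂ ∈ Finset.range n, ∑ j₃ ∈ Finset.range n, ∑ j₄ ∈ Finset.range n,
        chainWeight i₁ i₂ i₃ i₄ * chainWeight j₁ j₂ j₃ j₄ *
          ((A i₁ j₁ * A i₂ j₂) * (A i₃ j₃ * A i₄ j₄)) := by
  refine tabVal_tab n (fun i₁ i₂ j₁ j₂ => A i₁ j₁ * A i₂ j₂) (fun i₁ i₂ j₁ j₂ => A i₁ j₁ * A i₂ j₂)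
    _ _ (fun u u' => ?_) (fun u u' => ?_)
  · rw [map_rowPre_tab, colPre_tab, tabMul_tab]
    simp only [Finset.mul_sum]
    exact tab_congr fun a _ b _ => Finset.sum_congr rfl fun i _ => Finset.sum_congr rfl fun j _ =>
      by ring
  · rw [map_rowSuf_tab, colSuf_tab, tabMul_tab]
    simp only [Finset.mul_sum]
    exact tab_congr fun a _ b _ => Finset.sum_congr rfl fun i _ => Finset.sum_congr rfl fun j _ =>
      by ring

theorem val2143_tab (n : ℕ) (A : ℕ → ℕ → ℕ) :
    val2143 n (tab n A) =
      ∑ i₁ ∈ Finset.range n, ∑ i₂ ∈ Finset.range n, ∑ i₃ ∈ Finset.range n, ∑ i₄ ∈ Finset.range n,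
      ∑ j₁ ∈ Finset.range n, ∑ j₂ ∈ Finset.range n, ∑ j₃ ∈ Finset.range n, ∑ j₄ ∈ Finset.range n,
        chainWeight i₁ i₂ i₃ i₄ * chainWeight j₁ j₂ j₃ j₄ *
          ((A i₁ j₂ * A i₂ j₁) * (A i₃ j₄ * A i₄ j₃)) := by
  refine tabVal_tab n (fun i₁ i₂ j₁ j₂ => A i₁ j₂ * A i₂ j₁) (fun i₁ i₂ j₁ j₂ => A i₁ j₂ * A i₂ j₁)
    _ _ (fun u u' => ?_) (fun u u' => ?_)
  · rw [map_rowPre_tab, colPre_tab, tabMul_tab]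
    simp only [Finset.sum_mul_sum]
    exact tab_congr fun a _ b _ => Finset.sum_congr rfl fun i _ => Finset.sum_congr rfl fun j _ =>
      by ring
  · rw [map_rowSuf_tab, colSuf_tab, tabMul_tab]
    simp only [Finset.sum_mul_sum]
    exact tab_congr fun a _ b _ => Finset.sum_congr rfl fun i _ => Finset.sum_congr rfl fun j _ =>
      by ring

theorem sum_chain_factor₃ (s : Finset ℕ) (r₁ r₂ s₁ s₂ A : ℕ → ℕ → ℕ) :
    ∑ i₁ ∈ s, ∑ i₂ ∈ s, ∑ i₃ ∈ s, ∑ j₁ ∈ s, ∑ j₂ ∈ s, ∑ j₃ ∈ s,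
      (r₁ i₁ i₂ * r₂ i₂ i₃) * (s₁ j₁ j₂ * s₂ j₂ j₃) * (A i₁ j₁ * A i₂ j₂ * A i₃ j₃) =
    ∑ i₂ ∈ s, ∑ j₂ ∈ s, A i₂ j₂ *
      ((∑ i₁ ∈ s, r₁ i₁ i₂ * ∑ j₁ ∈ s, s₁ j₁ j₂ * A i₁ j₁) *
        ∑ i₃ ∈ s, r₂ i₂ i₃ * ∑ j₃ ∈ s, s₂ j₂ j₃ * A i₃ j₃) := by
  simp only [Finset.mul_sum, Finset.sum_mul, ← Finset.sum_product']
  refine Finset.sum_nbij'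
    (fun ⟨i₁, i₂, i₃, j₁, j₂, j₃⟩ => ⟨i₂, j₂, ⟨i₃, j₃⟩, i₁, j₁⟩)
    (fun ⟨i₂, j₂, ⟨i₃, j₃⟩, i₁, j₁⟩ => ⟨i₁, i₂, i₃, j₁, j₂, j₃⟩) ?_ ?_ ?_ ?_ ?_
  · rintro ⟨i₁, i₂, i₃, j₁, j₂, j₃⟩ h
    simp only [Finset.mem_product] at h ⊢; tauto
  · rintro ⟨i₂, j₂, ⟨i₃, j₃⟩, i₁, j₁⟩ h
    simp only [Finset.mem_product] at h ⊢; tauto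
  · rintro ⟨i₁, i₂, i₃, j₁, j₂, j₃⟩ _; rfl
  · rintro ⟨i₂, j₂, ⟨i₃, j₃⟩, i₁, j₁⟩ _; rfl
  · rintro ⟨i₁, i₂, i₃, j₁, j₂, j₃⟩ _
    ring

theorem val123_tab (n : ℕ) (A : ℕ → ℕ → ℕ) :
    val123 n (tab n A) =
      ∑ i₁ ∈ Finset.range n, ∑ i₂ ∈ Finset.range n, ∑ i₃ ∈ Finset.range n,
      ∑ j₁ ∈ Finset.range n, ∑ j₂ ∈ Finset.range n, ∑ j₃ ∈ Finset.range n,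
        chainWeight₃ i₁ i₂ i₃ * chainWeight₃ j₁ j₂ j₃ * (A i₁ j₁ * A i₂ j₂ * A i₃ j₃) := by
  have h : ∀ i₁ i₂ i₃ j₁ j₂ j₃ x : ℕ, chainWeight₃ i₁ i₂ i₃ * chainWeight₃ j₁ j₂ j₃ * x =
      (chainTerms₃.map fun m => (chainTerms₃.map fun m' =>
        kern m.1 i₁ i₂ * kern m.2 i₂ i₃ *
          (kern m'.1 j₁ j₂ * kern m'.2 j₂ j₃) * x).sum).sum := by
    intros
    simp only [chainWeight₃, ← List.sum_map_mul_right]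
    simp only [← List.sum_map_mul_left]
    simp only [← List.sum_map_mul_right]
  simp only [h, sum_list_map_sum]
  simp only [val123, map_rowPre_tab, colPre_tab, map_rowSuf_tab, colSuf_tab, tabMul_tab,
    tabSum_tab, sum_chain_factor₃]

/-! ### Extraction of the coefficients of a form in three variables -/

/-- `∑ i j, g i * g j * ∏ a, A (i a) (j (σ a))`. -/
def chainSum {R : Type*} [CommSemiring R] {k n : ℕ} (g : (Fin k → Fin n) → R)
    (σ : Equiv.Perm (Fin k)) (A : Fin n → Fin n → R) : R :=
  ∑ i : Fin k → Fin n, ∑ j : Fin k → Fin n, g i * g j * ∏ a, A (i a) (j (σ a))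

def mixEntry {R : Type*} [CommSemiring R] {n : ℕ} (p : Fin 3 → Fin n → Fin n) (t : Fin 3 → R)
    (i j : Fin n) : R :=
  ∑ c, if p c i = j then t c else 0

/-- The coefficient of the monomial `t₀ ^ (k - r - s) * t₁ ^ r * t₂ ^ s` with
`e = r + (k + 1) * s`. -/
def chainCoeff {k n : ℕ} (g : (Fin k → Fin n) → ℕ) (σ : Equiv.Perm (Fin k))
    (p : Fin 3 → Fin n → Fin n) (e : ℕ) : ℕ :=
  ∑ c : Fin k → Fin 3,
    if (Finset.univ.filter fun a => c a = 1).card +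
        (k + 1) * (Finset.univ.filter fun a => c a = 2).card = e
    then ∑ i : Fin k → Fin n, ∑ j : Fin k → Fin n, g i * g j *
      ∏ a, (if p (c a) (i a) = j (σ a) then 1 else 0)
    else 0

theorem prod_comp_fin_three {R : Type*} [CommSemiring R] {k : ℕ} (c : Fin k → Fin 3)
    (t : Fin 3 → R) :
    ∏ a, t (c a) =
      t 0 ^ (k - (Finset.univ.filter fun a => c a = 1).card -
        (Finset.univ.filter fun a => c a = 2).card) *
      t 1 ^ (Finset.univ.filter fun a => c a = 1).card *
      t 2 ^ (Finset.univ.filter fun a => c a = 2).card := by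
  have h : ∏ a, t (c a) = ∏ v, t v ^ (Finset.univ.filter fun a => c a = v).card := by
    rw [← Finset.prod_fiberwise_of_maps_to (s := Finset.univ) (t := Finset.univ) (g := c)
      (fun _ _ => Finset.mem_univ _)]
    refine Finset.prod_congr rfl fun v _ => ?_
    rw [Finset.prod_congr rfl (g := fun _ => t v), Finset.prod_const]
    intro a ha
    rw [(Finset.mem_filter.mp ha).2]
  have hc : k = ∑ v, (Finset.univ.filter fun a => c a = v).card := by
    rw [← Finset.card_eq_sum_card_fiberwise (fun _ _ => Finset.mem_univ _)]; simp
  rw [Fin.sum_univ_three] at hc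
  rw [h, Fin.prod_univ_three]
  congr 3
  omega

/-- Expanding the product chooses a permutation `c a` for each point, and the choices are grouped by
the numbers $r,s$ of ones and twos. As $r\le k$, the pair is recovered from $e=r+(k+1)s$ by
remainder and quotient. Values of $e$ with $r+s>k$ have coefficient 0, so the truncated exponent is
harmless there. -/
theorem chainSum_mixEntry {R : Type*} [CommSemiring R] {k n : ℕ} (g : (Fin k → Fin n) → ℕ)
    (σ : Equiv.Perm (Fin k)) (p : Fin 3 → Fin n → Fin n) (t : Fin 3 → R) :
    chainSum (fun i => (g i : R)) σ (mixEntry p t) =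
      ∑ e ∈ Finset.range ((k + 1) * (k + 1)), (chainCoeff g σ p e : R) *
        (t 0 ^ (k - e % (k + 1) - e / (k + 1)) * t 1 ^ (e % (k + 1)) * t 2 ^ (e / (k + 1))) := by
  have h1 : ∀ i j : Fin k → Fin n, ∏ a, mixEntry p t (i a) (j (σ a)) =
      ∑ c : Fin k → Fin 3, (∏ a, t (c a)) *
        ∏ a, (if p (c a) (i a) = j (σ a) then (1 : R) else 0) := by
    intro i j
    unfold mixEntry
    rw [Finset.prod_univ_sum, Fintype.piFinset_univ]
    refine Finset.sum_congr rfl fun c _ => ?_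
    rw [← Finset.prod_mul_distrib]
    refine Finset.prod_congr rfl fun a _ => ?_
    split_ifs <;> simp
  have h2 : chainSum (fun i => (g i : R)) σ (mixEntry p t) =
      ∑ c : Fin k → Fin 3, (∏ a, t (c a)) *
        ((∑ i : Fin k → Fin n, ∑ j : Fin k → Fin n, g i * g j *
          ∏ a, (if p (c a) (i a) = j (σ a) then 1 else 0) : ℕ) : R) := by
    unfold chainSum
    simp_rw [h1, Finset.mul_sum]
    simp_rw [Finset.sum_comm (s := (Finset.univ : Finset (Fin k → Fin n)))
      (t := (Finset.univ : Finset (Fin k → Fin 3)))]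
    refine Finset.sum_congr rfl fun c _ => ?_
    push_cast
    simp_rw [Finset.mul_sum]
    refine Finset.sum_congr rfl fun i _ => Finset.sum_congr rfl fun j _ => ?_
    ring
  rw [h2]
  unfold chainCoeff
  push_cast
  simp_rw [Finset.sum_mul]
  rw [Finset.sum_comm]
  refine Finset.sum_congr rfl fun c _ => ?_
  set n₁ := (Finset.univ.filter fun a => c a = 1).card
  set n₂ := (Finset.univ.filter fun a => c a = 2).card
  have hn₁ : n₁ ≤ k := (Finset.card_le_univ _).trans (by simp)
  have hn₂ : n₂ ≤ k := (Finset.card_le_univ _).trans (by simp)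
  have hlt : n₁ + (k + 1) * n₂ < (k + 1) * (k + 1) := by nlinarith
  have hm : (n₁ + (k + 1) * n₂) % (k + 1) = n₁ := by
    rw [Nat.add_mul_mod_self_left, Nat.mod_eq_of_lt (by omega)]
  have hd : (n₁ + (k + 1) * n₂) / (k + 1) = n₂ := by
    rw [Nat.add_mul_div_left _ _ (by omega), Nat.div_eq_of_lt (by omega), zero_add]
  rw [Finset.sum_eq_single (n₁ + (k + 1) * n₂)]
  · rw [if_pos rfl, hm, hd, prod_comp_fin_three, mul_comm]
  · intro e _ he
    rw [if_neg (Ne.symm he), zero_mul]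
  · intro he
    exact absurd (Finset.mem_range.mpr hlt) he

theorem sum_mul_pow_lt (K : ℕ → ℕ) (B m : ℕ) (hK : ∀ e < m, K e < B) :
    ∑ e ∈ Finset.range m, K e * B ^ e < B ^ m := by
  induction m with
  | zero => simp
  | succ m ih =>
    rw [Finset.sum_range_succ]
    have h1 := ih fun e he => hK e (by omega)
    have h2 : K m + 1 ≤ B := hK m (by omega)
    calc _ < B ^ m + K m * B ^ m := by omega
      _ = (K m + 1) * B ^ m := by ring
      _ ≤ B * B ^ m := Nat.mul_le_mul_right _ h2
      _ = B ^ (m + 1) := by ring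

/-- The terms below $e$ sum to less than $B^e$ and those above are divisible by $B^{e+1}$, so no
carry reaches the digit. -/
theorem digit_of_sum (K : ℕ → ℕ) (B m : ℕ) (hK : ∀ e < m, K e < B) (e : ℕ) (he : e < m) :
    K e = (∑ e ∈ Finset.range m, K e * B ^ e) / B ^ e % B := by
  have hlow := sum_mul_pow_lt K B e fun e' h => hK e' (by omega)
  have hB : 0 < B := by have := hK e he; omega
  obtain ⟨d, hd⟩ : B ^ (e + 1) ∣ ∑ i ∈ Finset.Ico (e + 1) m, K i * B ^ i :=
    Finset.dvd_sum fun i hi => Dvd.dvd.mul_left (pow_dvd_pow _ (Finset.mem_Ico.mp hi).1) _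
  have hs : ∑ i ∈ Finset.range m, K i * B ^ i =
      (∑ i ∈ Finset.range e, K i * B ^ i) + B ^ e * (K e + B * d) := by
    rw [← Finset.sum_range_add_sum_Ico _ he, Finset.sum_range_succ, hd]
    ring
  rw [hs, Nat.add_mul_div_left _ _ (by positivity), Nat.div_eq_of_lt hlow, zero_add,
    Nat.add_mul_mod_self_left, Nat.mod_eq_of_lt (hK e he)]

/-- The coefficients of the form are the digits, in a large base `B`, of its value at
`(1, B, B ^ (k + 1))`. -/
theorem chainCoeff_eq {k n : ℕ} (g : (Fin k → Fin n) → ℕ) (σ : Equiv.Perm (Fin k))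
    (p : Fin 3 → Fin n → Fin n) (B v : ℕ) (hB : chainSum g σ (mixEntry p ![1, 1, 1]) < B)
    (hv : chainSum g σ (mixEntry p ![1, B, B ^ (k + 1)]) = v) (e : ℕ)
    (he : e < (k + 1) * (k + 1)) :
    chainCoeff g σ p e = v / B ^ e % B := by
  have h1 := chainSum_mixEntry g σ p (![1, 1, 1] : Fin 3 → ℕ)
  have h2 := chainSum_mixEntry g σ p (![1, B, B ^ (k + 1)] : Fin 3 → ℕ)
  simp only [Nat.cast_id, Matrix.cons_val_zero, Matrix.cons_val_one, Matrix.cons_val, one_pow,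
    mul_one, one_mul] at h1 h2
  -- At $(1,B,B^{k+1})$ the monomial with index $e$ takes the value $B^e$.
  simp_rw [← pow_mul, ← pow_add, Nat.mod_add_div] at h2
  rw [← hv]
  change _ = chainSum (fun i => g i) σ _ / _ % _
  rw [h2]
  -- The value at $(1,1,1)$ is the sum of all coefficients and hence bounds each of them; `hB` then
  -- makes them genuine digits.
  refine digit_of_sum _ B _ (fun e' he' => lt_of_le_of_lt ?_ hB) e he
  change _ ≤ chainSum (fun i => g i) σ _
  rw [h1]
  exact Finset.single_le_sum (f := chainCoeff g σ p) (fun _ _ => Nat.zero_le _)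
    (Finset.mem_range.mpr he')

/-! ### The three forms -/

theorem sum_fun_succ {R α : Type*} [AddCommMonoid R] [Fintype α] (k : ℕ)
    (F : (Fin (k + 1) → α) → R) :
    ∑ f, F f = ∑ a : α, ∑ g : Fin k → α, F (Matrix.vecCons a g) := by
  rw [← Equiv.sum_comp (Fin.consEquiv fun _ : Fin (k + 1) => α), Fintype.sum_prod_type]
  rfl

/-- The three permutations of the mixture, from `0`. -/
def mixLists : List ℕ × List ℕ × List ℕ :=
  ([30, 0, 28, 2, 26, 4, 24, 6, 22, 8, 20, 10, 18, 12, 16, 14,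
    17, 15, 19, 13, 21, 11, 23, 9, 25, 7, 27, 5, 29, 3, 31, 1],
  [16, 14, 18, 12, 20, 10, 22, 8, 24, 6, 26, 4, 28, 2, 30, 0,
    31, 1, 29, 3, 27, 5, 25, 7, 23, 9, 21, 11, 19, 13, 17, 15],
  [11, 26, 12, 25, 9, 1, 3, 15, 14, 27, 13, 31, 29, 21, 23, 24,
    7, 8, 10, 2, 0, 18, 4, 17, 16, 28, 30, 22, 6, 19, 5, 20])

def natEntry (x y z i j : ℕ) : ℕ :=
  (if mixLists.1.getD i 0 = j then x else 0) + (if mixLists.2.1.getD i 0 = j then y else 0) +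
    (if mixLists.2.2.getD i 0 = j then z else 0)

noncomputable def mixPerm (c : Fin 3) : Equiv.Perm (Fin 32) := ![pi1, pi2, pi3] c

set_option maxRecDepth 20000 in
theorem pi1_val (i : Fin 32) : (pi1 i : ℕ) = mixLists.1.getD i 0 := by
  revert i; decide +kernel

set_option maxRecDepth 20000 in
theorem pi2_val (i : Fin 32) : (pi2 i : ℕ) = mixLists.2.1.getD i 0 := by
  revert i; decide +kernel

set_option maxRecDepth 20000 in
theorem pi3_val (i : Fin 32) : (pi3 i : ℕ) = mixLists.2.2.getD i 0 := by
  revert i; decide +kernel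

theorem mixEntry_nat (x y z : ℕ) (i j : Fin 32) :
    mixEntry (fun c => mixPerm c) ![x, y, z] i j = natEntry x y z i j := by
  simp only [mixEntry, natEntry, Fin.sum_univ_three, Fin.ext_iff, ← pi1_val, ← pi2_val, ← pi3_val]
  rfl

theorem mixMatrix_apply (x y z : ℝ) (i j : Fin 32) :
    mixMatrix x y z i j = mixEntry (fun c => mixPerm c) ![x, y, z] i j := by
  simp [mixMatrix, mixEntry, mixPerm, Fin.sum_univ_three, Equiv.Perm.permMatrix,
    PEquiv.toMatrix_apply, Equiv.toPEquiv, eq_comm]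
  congr

def weight₄ {n : ℕ} (i : Fin 4 → Fin n) : ℕ := chainWeight (i 0) (i 1) (i 2) (i 3)

def weight₃ {n : ℕ} (i : Fin 3 → Fin n) : ℕ := chainWeight₃ (i 0) (i 1) (i 2)

theorem chainSum_p1234 (x y z : ℕ) :
    chainSum weight₄ p1234 (mixEntry (fun c => mixPerm c) ![x, y, z]) =
      val1234 32 (tab 32 (natEntry x y z)) := by
  have h : ∀ a, p1234 a = a := by intro a; ext; revert a; decide
  rw [val1234_tab]
  simp only [Finset.sum_range, chainSum, sum_fun_succ, weight₄, mixEntry_nat, h,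
    Fin.prod_univ_four]
  simp [mul_assoc]

theorem chainSum_p2143 (x y z : ℕ) :
    chainSum weight₄ p2143 (mixEntry (fun c => mixPerm c) ![x, y, z]) =
      val2143 32 (tab 32 (natEntry x y z)) := by
  have h0 : p2143 0 = 1 := by ext; decide
  have h1 : p2143 1 = 0 := by ext; decide
  have h2 : p2143 2 = 3 := by ext; decide
  have h3 : p2143 3 = 2 := by ext; decide
  rw [val2143_tab]
  simp only [Finset.sum_range, chainSum, sum_fun_succ, weight₄, mixEntry_nat,
    Fin.prod_univ_four, h0, h1, h2, h3]
  simp [mul_assoc]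

theorem chainSum_one_three (x y z : ℕ) :
    chainSum weight₃ 1 (mixEntry (fun c => mixPerm c) ![x, y, z]) =
      val123 32 (tab 32 (natEntry x y z)) := by
  rw [val123_tab]
  simp only [Finset.sum_range, chainSum, sum_fun_succ, weight₃, mixEntry_nat,
    Fin.prod_univ_three, Equiv.Perm.one_apply]
  simp

-- The first part rules out carries in base $2^{32}$; the literal in the second part packs all
-- coefficients of the quartic form, which `form1234` reads off.
set_option maxRecDepth 100000 in
theorem val1234_kronecker :
    val1234 32 (tab 32 (natEntry 1 1 1)) < 2 ^ 32 ∧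
      val1234 32 (tab 32 (natEntry 1 (2 ^ 32) ((2 ^ 32) ^ (4 + 1)))) =
        4722016540664149118608365223781264714318504578518519964304850809072688690402795506738568858302918769601650435791293832386005019045208312501068418093998085054631442468167138546852756963406444426311552 := by
  decide +kernel

theorem form1234 (x y z : ℝ) :
    chainSum (fun i => (weight₄ i : ℝ)) p1234 (mixMatrix x y z) =
      2766720 * x ^ 4 + 6585088 * x ^ 3 * y + 5580416 * x ^ 2 * y ^ 2 + 2472448 * x * y ^ 3 +
      710400 * y ^ 4 + 7645888 * x ^ 3 * z + 14511488 * x ^ 2 * y * z + 9296192 * x * y ^ 2 * z +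
      2430592 * y ^ 3 * z + 8638880 * x ^ 2 * z ^ 2 + 11955392 * x * y * z ^ 2 +
      4101920 * y ^ 2 * z ^ 2 + 4794688 * x * z ^ 3 + 3416704 * y * z ^ 3 + 1034976 * z ^ 4 := by
  have hA : mixMatrix x y z = mixEntry (fun c => mixPerm c) ![x, y, z] := by
    ext i j; exact mixMatrix_apply x y z i j
  have hB := val1234_kronecker.1
  have hv := val1234_kronecker.2
  rw [← chainSum_p1234] at hB hv
  rw [hA, chainSum_mixEntry, Finset.sum_congr rfl fun e he => by
    rw [chainCoeff_eq _ _ _ _ _ hB hv e (Finset.mem_range.mp he)]]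
  have h2 : (![x, y, z] : Fin 3 → ℝ) 2 = z := rfl
  norm_num [Finset.sum_range_succ, h2]
  ring

set_option maxRecDepth 100000 in
theorem val2143_kronecker :
    val2143 32 (tab 32 (natEntry 1 1 1)) < 2 ^ 32 ∧
      val2143 32 (tab 32 (natEntry 1 (2 ^ 32) ((2 ^ 32) ^ (4 + 1)))) =
        4727856464654705528488225923436561087238319190040499457854282318319475438876940067087524519031478164504276823390064657914539544543818483336616813447843677765615020823989175978002827668115782163955840 := by
  decide +kernel

theorem form2143 (x y z : ℝ) :
    chainSum (fun i => (weight₄ i : ℝ)) p2143 (mixMatrix x y z) =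
      196736 * x ^ 4 + 1981696 * x ^ 3 * y + 5642368 * x ^ 2 * y ^ 2 + 6126592 * x * y ^ 3 +
      2269184 * y ^ 4 + 1789504 * x ^ 3 * z + 9253504 * x ^ 2 * y * z +
      14888128 * x * y ^ 2 * z + 7424128 * y ^ 3 * z + 4231840 * x ^ 2 * z ^ 2 +
      12681664 * x * y * z ^ 2 + 9321760 * y ^ 2 * z ^ 2 + 3675328 * x * z ^ 3 +
      5203072 * y * z ^ 3 + 1036256 * z ^ 4 := by
  have hA : mixMatrix x y z = mixEntry (fun c => mixPerm c) ![x, y, z] := by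
    ext i j; exact mixMatrix_apply x y z i j
  have hB := val2143_kronecker.1
  have hv := val2143_kronecker.2
  rw [← chainSum_p2143] at hB hv
  rw [hA, chainSum_mixEntry, Finset.sum_congr rfl fun e he => by
    rw [chainCoeff_eq _ _ _ _ _ hB hv e (Finset.mem_range.mp he)]]
  have h2 : (![x, y, z] : Fin 3 → ℝ) 2 = z := rfl
  norm_num [Finset.sum_range_succ, h2]
  ring

set_option maxRecDepth 100000 in
theorem val123_kronecker :
    val123 32 (tab 32 (natEntry 1 1 1)) < 2 ^ 32 ∧
      val123 32 (tab 32 (natEntry 1 (2 ^ 32) ((2 ^ 32) ^ (3 + 1)))) =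
        1297744476084448567335622464782182037989944924981227919442873937763317528533741478552630938888469793335265906450969442032 := by
  decide +kernel

theorem form123 (x y z : ℝ) :
    chainSum (fun i => (weight₃ i : ℝ)) 1 (mixMatrix x y z) =
      46832 * x ^ 3 + 109200 * x ^ 2 * y + 87024 * x * y ^ 2 + 24656 * y ^ 3 +
      117408 * x ^ 2 * z + 194208 * x * y * z + 79536 * y ^ 2 * z + 105096 * x * z ^ 2 +
      88176 * y * z ^ 2 + 32936 * z ^ 3 := by
  have hA : mixMatrix x y z = mixEntry (fun c => mixPerm c) ![x, y, z] := by
    ext i j; exact mixMatrix_apply x y z i j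
  have hB := val123_kronecker.1
  have hv := val123_kronecker.2
  rw [← chainSum_one_three] at hB hv
  rw [hA, chainSum_mixEntry, Finset.sum_congr rfl fun e he => by
    rw [chainCoeff_eq _ _ _ _ _ hB hv e (Finset.mem_range.mp he)]]
  have h2 : (![x, y, z] : Fin 3 → ℝ) 2 = z := rfl
  norm_num [Finset.sum_range_succ, h2]
  ring

/-! ### Pattern densities of step permutons -/

theorem measurePreserving_comp_perm {α : Type*} [MeasurableSpace α] (μ : Measure α)
    [IsProbabilityMeasure μ] {k : ℕ} (τ : Equiv.Perm (Fin k)) :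
    MeasurePreserving (fun (p : Fin k → α) a => p (τ a)) (Measure.pi fun _ => μ)
      (Measure.pi fun _ => μ) := by
  refine ⟨by fun_prop, ?_⟩
  have h := Measure.map_infinitePi_infinitePi_of_inj (P := fun _ : Fin k => μ) τ.injective
  rwa [Measure.infinitePi_eq_pi] at h

theorem measurableSet_strictMono {α : Type*} [MeasurableSpace α] {k : ℕ}
    (f : Fin k → α → unitInterval) (hf : ∀ a, Measurable (f a)) :
    MeasurableSet {p | StrictMono fun a => f a p} := by
  have h : {p | StrictMono fun a => f a p} = ⋂ a, ⋂ b, ⋂ (_ : a < b), {p | f a p < f b p} := by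
    ext p; simp only [Set.mem_ofPred_eq, Set.mem_iInter]; rfl
  rw [h]
  exact MeasurableSet.iInter fun a => MeasurableSet.iInter fun b => MeasurableSet.iInter fun _ =>
    measurableSet_lt (hf a) (hf b)

/-- The lists of points that are increasing in the first coordinate and have pattern `σ`. -/
def orderedSet {k : ℕ} (σ : Equiv.Perm (Fin k)) : Set (Fin k → unitInterval × unitInterval) :=
  {p | StrictMono fun a => (p a).1} ∩ {p | StrictMono fun a => (p (σ.symm a)).2}

theorem measurableSet_orderedSet {k : ℕ} (σ : Equiv.Perm (Fin k)) :
    MeasurableSet (orderedSet σ) :=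
  (measurableSet_strictMono (fun a (p : Fin k → unitInterval × unitInterval) => (p a).1)
    (by fun_prop)).inter
    (measurableSet_strictMono
      (fun a (p : Fin k → unitInterval × unitInterval) => (p (σ.symm a)).2) (by fun_prop))

theorem hasPattern_iff {k : ℕ} (σ : Equiv.Perm (Fin k))
    (p : Fin k → unitInterval × unitInterval) :
    HasPattern σ p ↔ ∃ τ : Equiv.Perm (Fin k), (fun a => p (τ a)) ∈ orderedSet σ := by
  refine exists_congr fun τ => and_congr_right fun _ => ⟨fun h a b hab => ?_, fun h i j => ?_⟩
  · have := (h (σ.symm a) (σ.symm b)).mp (by simpa using hab)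
    simpa using this
  · have := (h.lt_iff_lt (a := σ i) (b := σ j))
    simpa using this.symm

theorem setOf_hasPattern {k : ℕ} (σ : Equiv.Perm (Fin k)) :
    {p | HasPattern σ p} =
      ⋃ τ : Equiv.Perm (Fin k), (fun (p : Fin k → unitInterval × unitInterval) a => p (τ a)) ⁻¹'
        orderedSet σ := by
  ext p; simp [hasPattern_iff]

theorem measurableSet_hasPattern {k : ℕ} (σ : Equiv.Perm (Fin k)) :
    MeasurableSet {p | HasPattern σ p} := by
  rw [setOf_hasPattern]
  exact MeasurableSet.iUnion fun τ => (by fun_prop : Measurable _) (measurableSet_orderedSet σ)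

theorem perm_eq_of_strictMono {α : Type*} [LinearOrder α] {k : ℕ} {x : Fin k → α}
    {τ τ' : Equiv.Perm (Fin k)} (h : StrictMono fun a => x (τ a))
    (h' : StrictMono fun a => x (τ' a)) : τ = τ' := by
  have he : x ∘ τ = x ∘ τ' := Tuple.unique_monotone h.monotone h'.monotone
  have hx : Function.Injective x := by
    have := h.injective.comp τ.symm.injective
    simpa [Function.comp_def] using this
  ext a
  exact congrArg Fin.val (hx (congrFun he a))

/-- The $k!$ ways of sorting the points by first coordinate give disjoint events, as the sorting
permutation is unique, and exchangeability gives them equal measure. -/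
theorem pi_hasPattern (μ : Measure (unitInterval × unitInterval)) [IsProbabilityMeasure μ] {k : ℕ}
    (σ : Equiv.Perm (Fin k)) :
    Measure.pi (fun _ : Fin k => μ) {p | HasPattern σ p} =
      k.factorial * Measure.pi (fun _ : Fin k => μ) (orderedSet σ) := by
  rw [setOf_hasPattern, measure_iUnion]
  · simp_rw [fun τ : Equiv.Perm (Fin k) => (measurePreserving_comp_perm μ τ).measure_preimage
      (measurableSet_orderedSet σ).nullMeasurableSet]
    rw [tsum_fintype, Finset.sum_const, Finset.card_univ, Fintype.card_perm, Fintype.card_fin,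
      nsmul_eq_mul]
  · intro τ τ' hne
    refine Set.disjoint_left.mpr fun p hp hp' => hne ?_
    exact perm_eq_of_strictMono (x := fun a => (p a).1) hp.1 hp'.1
  · exact fun τ => (by fun_prop : Measurable _) (measurableSet_orderedSet σ)

theorem pi_sum_smul {α ι : Type*} [MeasurableSpace α] [Fintype ι] [DecidableEq ι] (w : ι → ℝ≥0∞)
    (hw : ∀ c, w c ≠ ∞) (ν : ι → Measure α) [∀ c, IsFiniteMeasure (ν c)] (k : ℕ) :
    Measure.pi (fun _ : Fin k => ∑ c, w c • ν c) =
      ∑ f : Fin k → ι, (∏ a, w (f a)) • Measure.pi fun a => ν (f a) := by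
  have : ∀ c, IsFiniteMeasure (w c • ν c) := fun c => (ν c).smul_finite (hw c)
  refine Measure.pi_eq fun s _ => ?_
  simp only [Measure.coe_finsetSum, Finset.sum_apply, Measure.smul_apply, smul_eq_mul,
    Measure.pi_pi, ← Finset.prod_mul_distrib]
  rw [Finset.prod_univ_sum, Fintype.piFinset_univ]

/-- The interval `[i/n, (i+1)/n)`. -/
def slot {n : ℕ} (i : Fin n) : Set unitInterval :=
  {x | (x : ℝ) ∈ Set.Ico ((i : ℝ) / n) (((i : ℝ) + 1) / n)}

theorem measurableSet_slot {n : ℕ} (i : Fin n) : MeasurableSet (slot i) :=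
  measurable_subtype_coe measurableSet_Ico

theorem cell_eq {n : ℕ} (i j : Fin n) : cell i j = slot i ×ˢ slot j := rfl

theorem measurableSet_cell {n : ℕ} (i j : Fin n) : MeasurableSet (cell i j) :=
  (measurableSet_slot i).prod (measurableSet_slot j)

theorem volume_slot {n : ℕ} (i : Fin n) : volume (slot i) = ENNReal.ofReal (1 / n) := by
  have hn : (0 : ℝ) < n := by exact_mod_cast i.pos
  have hi : ((i : ℕ) : ℝ) + 1 ≤ n := by exact_mod_cast i.isLt
  have h0 : (0 : ℝ) ≤ (i : ℝ) / n := by positivity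
  have h1 : ((i : ℝ) + 1) / n ≤ 1 := by rw [div_le_one hn]; exact hi
  have h2 : (i : ℝ) / n ≤ ((i : ℝ) + 1) / n := by gcongr; linarith
  have h : slot i = Set.Ico (⟨(i : ℝ) / n, h0, h2.trans h1⟩ : unitInterval)
      ⟨((i : ℝ) + 1) / n, h0.trans h2, h1⟩ := rfl
  rw [h, unitInterval.volume_Ico]
  congr 1
  simp only
  field_simp
  ring

theorem lt_of_mem_slot {n : ℕ} {i j : Fin n} (hij : i < j) {x y : unitInterval} (hx : x ∈ slot i)
    (hy : y ∈ slot j) : x < y := by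
  have h : ((i : ℕ) : ℝ) + 1 ≤ (j : ℕ) := by exact_mod_cast hij
  have h2 : (((i : ℕ) : ℝ) + 1) / n ≤ ((j : ℕ) : ℝ) / n := by gcongr
  exact Subtype.coe_lt_coe.mp (lt_of_lt_of_le hx.2 (h2.trans hy.1))

/-- The increasing tuples of points of the intervals `i₁, …, i_k`. -/
def increasingBox {k n : ℕ} (i : Fin k → Fin n) : Set (Fin k → unitInterval) :=
  {x | StrictMono x} ∩ Set.univ.pi fun a => slot (i a)

theorem measurableSet_increasingBox {k n : ℕ} (i : Fin k → Fin n) :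
    MeasurableSet (increasingBox i) :=
  (measurableSet_strictMono (fun a (x : Fin k → unitInterval) => x a) (by fun_prop)).inter
    (MeasurableSet.univ_pi fun a => measurableSet_slot (i a))

/-- The probability that uniform points of the intervals `i₁, …, i_k` increase. -/
noncomputable def orderWeight {k n : ℕ} (i : Fin k → Fin n) : ℝ :=
  open Classical in
  if Monotone i then
    1 / ((Finset.univ.filter fun τ : Equiv.Perm (Fin k) => ∀ a, i (τ a) = i a).card : ℝ) else 0

/-- Ties are null because the law of $f$ has no atoms. This serves both for uniform points and for
the coordinates of points sampled from a permuton. -/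
theorem ae_injective_pi {α : Type*} [MeasurableSpace α] (μ : Measure α) [IsProbabilityMeasure μ]
    {f : α → unitInterval} (hf : Measurable f) (hμ : μ.map f = volume) (k : ℕ) :
    ∀ᵐ p ∂Measure.pi fun _ : Fin k => μ, Function.Injective fun a => f (p a) := by
  have h : ∀ a b : Fin k, a ≠ b → ∀ᵐ p ∂Measure.pi fun _ : Fin k => μ, f (p a) ≠ f (p b) := by
    intro a b hab
    have h1 := Measure.infinitePi_map_eval_prod (P := fun _ : Fin k => μ) hab
    rw [Measure.infinitePi_eq_pi] at h1
    have h2 : ∀ᵐ q ∂μ.prod μ, f q.1 ≠ f q.2 := by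
      refine (Measure.ae_prod_mem_iff_ae_ae_mem (s := {q | f q.1 ≠ f q.2})
        (measurableSet_eq_fun (hf.comp measurable_fst) (hf.comp measurable_snd)).compl).mpr ?_
      refine Filter.Eventually.of_forall fun x => ?_
      have h3 := (Set.countable_singleton (f x)).ae_notMem (volume : Measure unitInterval)
      rw [← hμ] at h3
      filter_upwards [ae_of_ae_map hf.aemeasurable h3] with y hy
      exact fun h => hy (by simp [h])
    rw [← h1] at h2
    exact ae_of_ae_map (f := fun ω : Fin k → α => (ω a, ω b))
      (p := fun q : α × α => f q.1 ≠ f q.2) (by fun_prop) h2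
  have h' : ∀ᵐ p ∂Measure.pi fun _ : Fin k => μ, ∀ a b : Fin k, a ≠ b → f (p a) ≠ f (p b) := by
    rw [ae_all_iff]; intro a; rw [ae_all_iff]; intro b
    by_cases hab : a = b
    · simp [hab]
    · filter_upwards [h a b hab] with x hx _ using hx
  filter_upwards [h'] with x hx a b hab
  by_contra hne
  exact hx a b hne hab

theorem monotone_of_mem_slot {k n : ℕ} {i : Fin k → Fin n} {x : Fin k → unitInterval}
    (hx : Monotone x) (h : ∀ a, x a ∈ slot (i a)) : Monotone i := by
  intro a b hab
  by_contra hlt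
  exact absurd (hx hab) (not_le.mpr (lt_of_mem_slot (not_le.mp hlt) (h b) (h a)))

/-- If $i$ is not monotone the set is empty. Otherwise, almost every point of the box is sorted by a
unique permutation, which must stabilise $i$ because a tuple has only one monotone rearrangement.
The stabiliser thus cuts the box, up to a null set, into pieces of equal volume. -/
theorem volume_increasingBox {k n : ℕ} (i : Fin k → Fin n) :
    volume (increasingBox i) = ENNReal.ofReal (orderWeight i / n ^ k) := by
  classical
  unfold orderWeight
  split_ifs with hi
  swap
  · have : increasingBox i = ∅ := by
      refine Set.eq_empty_iff_forall_notMem.mpr fun x hx => hi ?_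
      exact monotone_of_mem_slot (StrictMono.monotone hx.1) fun a => hx.2 a (Set.mem_univ a)
    simp [this]
  set S := Finset.univ.filter fun τ : Equiv.Perm (Fin k) => ∀ a, i (τ a) = i a with hS
  have hcard : 0 < S.card := Finset.card_pos.mpr ⟨1, by simp [hS]⟩
  have hbox : volume (Set.univ.pi fun a => slot (i a)) = ENNReal.ofReal ((1 / n) ^ k) := by
    rw [volume_pi_pi]
    simp only [volume_slot, Finset.prod_const, Finset.card_univ, Fintype.card_fin]
    rw [ENNReal.ofReal_pow (by positivity)]
  have hae : (Set.univ.pi fun a => slot (i a)) =ᵐ[volume]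
      ⋃ τ ∈ S, (fun (x : Fin k → unitInterval) a => x (τ a)) ⁻¹' increasingBox i := by
    refine Filter.eventuallyEq_set.mpr ?_
    filter_upwards [ae_injective_pi (volume : Measure unitInterval) measurable_id
      Measure.map_id k] with x hx
    simp only [Set.mem_iUnion, Set.mem_preimage, exists_prop]
    constructor
    · intro hxi
      have hm := Tuple.monotone_sort x
      have hmem : ∀ a, x (Tuple.sort x a) ∈ slot (i (Tuple.sort x a)) :=
        fun a => hxi _ (Set.mem_univ _)
      have him : Monotone (i ∘ Tuple.sort x) := monotone_of_mem_slot hm hmem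
      have hii : i ∘ Tuple.sort x = i ∘ (1 : Equiv.Perm (Fin k)) :=
        Tuple.unique_monotone him (by simpa using hi)
      have hii' : ∀ a, i (Tuple.sort x a) = i a := fun a => congrFun hii a
      refine ⟨Tuple.sort x, by simpa [hS] using hii', ?_, fun a _ => ?_⟩
      · exact hm.strictMono_of_injective (hx.comp (Tuple.sort x).injective)
      · change x (Tuple.sort x a) ∈ slot (i a)
        rw [← hii' a]; exact hmem a
    · rintro ⟨τ, hτ, hxτ⟩ a _
      have h1 := hxτ.2 (τ.symm a) (Set.mem_univ _)
      have h2 : i (τ (τ.symm a)) = i (τ.symm a) := (Finset.mem_filter.mp hτ).2 _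
      simp only [Equiv.apply_symm_apply] at h1 h2
      change x a ∈ slot (i a)
      rwa [h2]
  have hsum : volume (Set.univ.pi fun a => slot (i a)) =
      S.card * volume (increasingBox i) := by
    rw [measure_congr hae, measure_biUnion_finset]
    · simp_rw [volume_pi, fun τ : Equiv.Perm (Fin k) =>
        (measurePreserving_comp_perm (volume : Measure unitInterval) τ).measure_preimage
          (measurableSet_increasingBox i).nullMeasurableSet]
      rw [Finset.sum_const, nsmul_eq_mul]
    · intro τ _ τ' _ hne
      refine Set.disjoint_left.mpr fun p hp hp' => hne ?_
      exact perm_eq_of_strictMono (x := p) hp.1 hp'.1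
    · exact fun τ _ => (by fun_prop : Measurable _) (measurableSet_increasingBox i)
  have hfin : volume (increasingBox i) ≠ ∞ := measure_ne_top _ _
  rw [← ENNReal.ofReal_toReal hfin]
  congr 1
  have := congrArg ENNReal.toReal (hbox.symm.trans hsum)
  rw [ENNReal.toReal_ofReal (by positivity), ENNReal.toReal_mul, ENNReal.toReal_natCast] at this
  have hc : (S.card : ℝ) ≠ 0 := by exact_mod_cast hcard.ne'
  rw [one_div_pow] at this
  field_simp
  rw [this]
  ring

/-- The uniform measure on the square is a product, so the order of the first coordinates and the
order of the second, relabelled by $\sigma^{-1}$, are independent. -/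
theorem volume_orderedSet_inter {k n : ℕ} (σ : Equiv.Perm (Fin k)) (i j : Fin k → Fin n) :
    volume (orderedSet σ ∩ Set.univ.pi fun a => cell (i a) (j a)) =
      volume (increasingBox i) * volume (increasingBox fun a => j (σ.symm a)) := by
  have h1 := measurePreserving_arrowProdEquivProdArrow unitInterval unitInterval (Fin k)
    (fun _ => volume) (fun _ => volume)
  have h2 := measurePreserving_comp_perm (volume : Measure unitInterval) σ.symm
  have hY : MeasurableSet ((fun (y : Fin k → unitInterval) a => y (σ.symm a)) ⁻¹'
      increasingBox fun a => j (σ.symm a)) := h2.measurable (measurableSet_increasingBox _)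
  have hset : orderedSet σ ∩ (Set.univ.pi fun a => cell (i a) (j a)) =
      MeasurableEquiv.arrowProdEquivProdArrow unitInterval unitInterval (Fin k) ⁻¹'
        (increasingBox i ×ˢ ((fun (y : Fin k → unitInterval) a => y (σ.symm a)) ⁻¹'
          increasingBox fun a => j (σ.symm a))) := by
    ext p
    constructor
    · rintro ⟨⟨hx, hy⟩, hc⟩
      exact ⟨⟨hx, fun a _ => (hc a (Set.mem_univ a)).1⟩, hy,
        fun a _ => (hc _ (Set.mem_univ (σ.symm a))).2⟩
    · rintro ⟨⟨hx, hxi⟩, hy, hyj⟩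
      refine ⟨⟨hx, hy⟩, fun a _ => ⟨hxi a (Set.mem_univ a), ?_⟩⟩
      have := hyj (σ a) (Set.mem_univ _)
      simp only [Equiv.symm_apply_apply] at this
      exact this
  rw [hset]
  refine (h1.measure_preimage ((measurableSet_increasingBox i).prod hY).nullMeasurableSet).trans ?_
  rw [Measure.prod_prod]
  congr 1
  exact h2.measure_preimage (measurableSet_increasingBox _).nullMeasurableSet

/-! ### Step permutons: uniform marginals and pattern densities. -/

theorem stepMeasure_eq {n : ℕ} (A : Matrix (Fin n) (Fin n) ℝ) :
    stepMeasure A = ∑ c : Fin n × Fin n, ENNReal.ofReal (n * A c.1 c.2) •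
      (volume : Measure (unitInterval × unitInterval)).restrict (cell c.1 c.2) := by
  unfold stepMeasure
  rw [Fintype.sum_prod_type, Finset.smul_sum]
  refine Finset.sum_congr rfl fun i _ => ?_
  rw [Finset.smul_sum]
  refine Finset.sum_congr rfl fun j _ => ?_
  rw [smul_smul, ENNReal.ofReal_mul (by positivity), ENNReal.ofReal_natCast]

theorem sum_restrict_slot {n : ℕ} (hn : 0 < n) :
    ∑ i : Fin n, (volume : Measure unitInterval).restrict (slot i) = volume := by
  have hn' : (0 : ℝ) < n := by exact_mod_cast hn
  have hd : Pairwise (Function.onFun Disjoint (slot : Fin n → Set unitInterval)) := by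
    intro i j hij
    refine Set.disjoint_left.mpr fun x hi hj => ?_
    rcases lt_or_gt_of_ne hij with h | h
    · exact lt_irrefl x (lt_of_mem_slot h hi hj)
    · exact lt_irrefl x (lt_of_mem_slot h hj hi)
  have h := Measure.restrict_iUnion (μ := (volume : Measure unitInterval)) hd measurableSet_slot
  rw [Measure.sum_fintype] at h
  rw [← h]
  have hu : (⋃ i : Fin n, slot i) =ᵐ[volume] (Set.univ : Set unitInterval) := by
    refine Filter.eventuallyEq_set.mpr ?_
    -- The half-open slots miss only the endpoint 1, a null set.
    filter_upwards [(Set.countable_singleton (1 : unitInterval)).ae_notMem volume] with x hx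
    have hx1 : (x : ℝ) < 1 := lt_of_le_of_ne x.2.2 fun h => hx (Subtype.ext h)
    have hlt : ⌊(n : ℝ) * x⌋₊ < n := by
      rw [Nat.floor_lt (by have := x.2.1; positivity)]
      nlinarith
    simp only [Set.mem_iUnion, Set.mem_univ, iff_true]
    refine ⟨⟨⌊(n : ℝ) * x⌋₊, hlt⟩, ?_, ?_⟩
    · rw [div_le_iff₀ hn', mul_comm (x : ℝ)]
      exact Nat.floor_le (by have := x.2.1; positivity)
    · rw [lt_div_iff₀ hn', mul_comm (x : ℝ)]
      exact Nat.lt_floor_add_one _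
  rw [Measure.restrict_congr_set hu, Measure.restrict_univ]

theorem isPermuton_stepMeasure {n : ℕ} (hn : 0 < n) (A : Matrix (Fin n) (Fin n) ℝ)
    (hA : A ∈ doublyStochastic ℝ (Fin n)) : IsPermuton (stepMeasure A) := by
  rw [mem_doublyStochastic_iff_sum] at hA
  obtain ⟨h0, hrow, hcol⟩ := hA
  have hn' : (0 : ℝ) < n := by exact_mod_cast hn
  have hone : ∀ f : Fin n → ℝ, (∀ j, 0 ≤ f j) → ∑ j, f j = 1 →
      ∑ j, ENNReal.ofReal (n * f j) * ENNReal.ofReal (1 / n) = 1 := by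
    intro f hf hs
    have : ∀ j, ENNReal.ofReal (n * f j) * ENNReal.ofReal (1 / n) = ENNReal.ofReal (f j) := by
      intro j
      rw [← ENNReal.ofReal_mul (mul_nonneg hn'.le (hf j))]
      congr 1; field_simp
    simp_rw [this]
    rw [← ENNReal.ofReal_sum_of_nonneg fun j _ => hf j, hs, ENNReal.ofReal_one]
  have hcell : ∀ i j : Fin n, (volume : Measure (unitInterval × unitInterval)).restrict (cell i j)
      = ((volume : Measure unitInterval).restrict (slot i)).prod
        ((volume : Measure unitInterval).restrict (slot j)) := by
    intro i j
    rw [cell_eq, Measure.prod_restrict]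
    rfl
  have hfst : (stepMeasure A).map Prod.fst = volume := by
    rw [stepMeasure_eq, Measure.map_finset_sum' measurable_fst.aemeasurable,
      Fintype.sum_prod_type]
    conv_rhs => rw [← sum_restrict_slot hn]
    refine Finset.sum_congr rfl fun i _ => ?_
    simp only [Measure.map_smul, hcell, Measure.map_fst_prod, Measure.restrict_apply_univ,
      volume_slot, smul_smul]
    rw [← Finset.sum_smul, hone _ (h0 i) (hrow i), one_smul]
  have hsnd : (stepMeasure A).map Prod.snd = volume := by
    rw [stepMeasure_eq, Measure.map_finset_sum' measurable_snd.aemeasurable,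
      Fintype.sum_prod_type_right]
    conv_rhs => rw [← sum_restrict_slot hn]
    refine Finset.sum_congr rfl fun j _ => ?_
    simp only [Measure.map_smul, hcell, Measure.map_snd_prod, Measure.restrict_apply_univ,
      volume_slot, smul_smul]
    rw [← Finset.sum_smul, hone _ (fun i => h0 i j) (hcol j), one_smul]
  refine ⟨⟨?_⟩, hfst, hsnd⟩
  have := congrArg (fun m => m Set.univ) hfst
  simpa [Measure.map_apply measurable_fst MeasurableSet.univ] using this

/-- The product measure is expanded over the cells chosen for the $k$ points. The factors $n$ of the
step measure contribute $n^k$ and the two order events $n^{-k}$ each, which leaves $n^{-k}$. -/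
theorem permutonDensity_stepMeasure {k n : ℕ} (hn : 0 < n) (σ : Equiv.Perm (Fin k))
    (A : Matrix (Fin n) (Fin n) ℝ) (hA : A ∈ doublyStochastic ℝ (Fin n)) :
    permutonDensity σ (stepMeasure A) =
      k.factorial / (n : ℝ) ^ k * chainSum orderWeight σ A := by
  have hP := (isPermuton_stepMeasure hn A hA).isProbabilityMeasure
  have h0 : ∀ i j, 0 ≤ A i j := (mem_doublyStochastic_iff_sum.mp hA).1
  have hn' : (0 : ℝ) < n := by exact_mod_cast hn
  have hw : ∀ {i : Fin k → Fin n}, 0 ≤ orderWeight i := by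
    intro i; unfold orderWeight; split_ifs <;> positivity
  have hreal : (Measure.pi (fun _ : Fin k => stepMeasure A)) (orderedSet σ) =
      ENNReal.ofReal ((1 / (n : ℝ) ^ k) * chainSum orderWeight σ A) := by
    have hterm : ∀ f : Fin k → Fin n × Fin n,
        ((∏ a, ENNReal.ofReal (n * A (f a).1 (f a).2)) •
          Measure.pi fun a => (volume : Measure (unitInterval × unitInterval)).restrict
            (cell (f a).1 (f a).2)) (orderedSet σ) =
        ENNReal.ofReal (orderWeight (fun a => (f a).1) * orderWeight (fun a => (f (σ.symm a)).2) *
          (∏ a, A (f a).1 (f a).2) * (1 / (n : ℝ) ^ k)) := by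
      intro f
      rw [← Measure.restrict_pi_pi, Measure.smul_apply, smul_eq_mul,
        Measure.restrict_apply (measurableSet_orderedSet σ), ← volume_pi,
        volume_orderedSet_inter σ (fun a => (f a).1) (fun a => (f a).2), volume_increasingBox,
        volume_increasingBox, ← ENNReal.ofReal_prod_of_nonneg
          (fun a _ => mul_nonneg hn'.le (h0 _ _)),
        ← ENNReal.ofReal_mul (div_nonneg hw (by positivity)),
        ← ENNReal.ofReal_mul (Finset.prod_nonneg fun a _ => mul_nonneg hn'.le (h0 _ _))]
      congr 1
      rw [Finset.prod_mul_distrib, Finset.prod_const, Finset.card_univ, Fintype.card_fin]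
      field_simp
    rw [stepMeasure_eq, pi_sum_smul _ (fun _ => ENNReal.ofReal_ne_top)]
    simp only [Measure.coe_finsetSum, Finset.sum_apply, hterm]
    rw [← ENNReal.ofReal_sum_of_nonneg fun f _ => by
      have : 0 ≤ ∏ a, A (f a).1 (f a).2 := Finset.prod_nonneg fun a _ => h0 _ _
      have h1 := @hw fun a => (f a).1
      have h2 := @hw fun a => (f (σ.symm a)).2
      positivity]
    congr 1
    rw [← Finset.sum_mul, mul_comm]
    congr 1
    rw [← Equiv.sum_comp (Equiv.arrowProdEquivProdArrow (Fin k) (fun _ => Fin n)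
      (fun _ => Fin n)).symm, Fintype.sum_prod_type]
    unfold chainSum
    refine Finset.sum_congr rfl fun i _ => ?_
    -- The columns are reindexed by rank of value instead of by position.
    rw [← Equiv.sum_comp (σ.symm.arrowCongr (Equiv.refl (Fin n)))]
    refine Finset.sum_congr rfl fun j _ => ?_
    simp [Equiv.arrowProdEquivProdArrow, Equiv.arrowCongr]
  unfold permutonDensity
  rw [Measure.real, pi_hasPattern, ENNReal.toReal_mul, ENNReal.toReal_natCast, hreal,
    ENNReal.toReal_ofReal]
  · ring
  · refine mul_nonneg (by positivity) (Finset.sum_nonneg fun i _ => Finset.sum_nonneg fun j _ => ?_)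
    exact mul_nonneg (mul_nonneg hw hw) (Finset.prod_nonneg fun a _ => h0 _ _)

/-! ### Order weights of chains of three and four points in closed form. -/

theorem card_stabilizer_congr {k n : ℕ} (i : Fin k → Fin n) (b : Fin k → ℕ)
    (h : ∀ x y, i x = i y ↔ b x = b y) :
    (Finset.univ.filter fun τ : Equiv.Perm (Fin k) => ∀ a, i (τ a) = i a).card =
      (Finset.univ.filter fun τ : Equiv.Perm (Fin k) => ∀ a, b (τ a) = b a).card := by
  simp only [h]

/-- The stabiliser depends only on which entries of $i$ coincide, so an explicit model `b` makes its
order decidable. -/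
theorem orderWeight_of_monotone {k n : ℕ} {i : Fin k → Fin n} (hi : Monotone i)
    (b : Fin k → ℕ) (h : ∀ x y, i x = i y ↔ b x = b y) :
    orderWeight i =
      1 / ((Finset.univ.filter fun τ : Equiv.Perm (Fin k) => ∀ a, b (τ a) = b a).card : ℝ) := by
  rw [orderWeight, if_pos hi, ← card_stabilizer_congr i b h]

/-- The eight cases record which consecutive entries are equal. In each, `m` is the order of the
stabiliser, the product of the factorials of the block sizes, and `w` is $24/m$. -/
theorem weight₄_eq {n : ℕ} (i : Fin 4 → Fin n) : (weight₄ i : ℝ) = 24 * orderWeight i := by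
  by_cases hi : Monotone i
  · have h01 : i 0 ≤ i 1 := hi (by decide)
    have h12 : i 1 ≤ i 2 := hi (by decide)
    have h23 : i 2 ≤ i 3 := hi (by decide)
    have key : ∀ b : Fin 4 → ℕ, (∀ x y, i x = i y ↔ b x = b y) → ∀ m w : ℕ,
        (Finset.univ.filter fun τ : Equiv.Perm (Fin 4) => ∀ a, b (τ a) = b a).card = m →
        weight₄ i = w → w * m = 24 → m ≠ 0 → (weight₄ i : ℝ) = 24 * orderWeight i := by
      intro b hb m w hm hw hwm hm0
      rw [orderWeight_of_monotone hi b hb, hm, hw]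
      have h1 : (m : ℝ) ≠ 0 := by exact_mod_cast hm0
      have h2 : (w : ℝ) * m = 24 := by exact_mod_cast hwm
      field_simp
      exact h2
    rw [Fin.le_def] at h01 h12 h23
    rcases h01.eq_or_lt with e1 | e1 <;> rcases h12.eq_or_lt with e2 | e2 <;>
      rcases h23.eq_or_lt with e3 | e3
    · refine key ![0, 0, 0, 0] ?_ 24 1 (by decide) ?_ (by norm_num) (by norm_num)
      · intro x y; fin_cases x <;> fin_cases y <;> simp [Fin.ext_iff] <;> omega
      · simp [weight₄, chainWeight, chainTerms, kern, e1, e2, e3]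
    · refine key ![0, 0, 0, 1] ?_ 6 4 (by decide) ?_ (by norm_num) (by norm_num)
      · intro x y; fin_cases x <;> fin_cases y <;> simp [Fin.ext_iff] <;> omega
      · simp [weight₄, chainWeight, chainTerms, kern, e1, e2, e3]
    · refine key ![0, 0, 1, 1] ?_ 4 6 (by decide) ?_ (by norm_num) (by norm_num)
      · intro x y; fin_cases x <;> fin_cases y <;> simp [Fin.ext_iff] <;> omega
      · simp [weight₄, chainWeight, chainTerms, kern, e1, e3, e3 ▸ e2]
    · refine key ![0, 0, 1, 2] ?_ 2 12 (by decide) ?_ (by norm_num) (by norm_num)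
      · intro x y; fin_cases x <;> fin_cases y <;> simp [Fin.ext_iff] <;> omega
      · simp [weight₄, chainWeight, chainTerms, kern, e1, e2, e3]
    · refine key ![0, 1, 1, 1] ?_ 6 4 (by decide) ?_ (by norm_num) (by norm_num)
      · intro x y; fin_cases x <;> fin_cases y <;> simp [Fin.ext_iff] <;> omega
      · have h : (i 0 : ℕ) < i 3 := by omega
        simp [weight₄, chainWeight, chainTerms, kern, e2, e3, h]
    · refine key ![0, 1, 1, 2] ?_ 2 12 (by decide) ?_ (by norm_num) (by norm_num)
      · intro x y; fin_cases x <;> fin_cases y <;> simp [Fin.ext_iff] <;> omega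
      · have h : (i 0 : ℕ) < i 2 := by omega
        simp [weight₄, chainWeight, chainTerms, kern, e2, e3, h]
    · refine key ![0, 1, 2, 2] ?_ 2 12 (by decide) ?_ (by norm_num) (by norm_num)
      · intro x y; fin_cases x <;> fin_cases y <;> simp [Fin.ext_iff] <;> omega
      · have h : (i 1 : ℕ) < i 3 := by omega
        simp [weight₄, chainWeight, chainTerms, kern, e1, e3, h]
    · refine key ![0, 1, 2, 3] ?_ 1 24 (by decide) ?_ (by norm_num) (by norm_num)
      · intro x y; fin_cases x <;> fin_cases y <;> simp [Fin.ext_iff] <;> omega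
      · simp [weight₄, chainWeight, chainTerms, kern, e1, e2, e3]
  · have h : (i 1 : ℕ) < i 0 ∨ (i 2 : ℕ) < i 1 ∨ (i 3 : ℕ) < i 2 := by
      by_contra hcon
      refine hi (Fin.monotone_iff_le_succ.mpr fun a => ?_)
      rw [Fin.le_def]
      fin_cases a <;> simp <;> omega
    rw [orderWeight, if_neg hi, mul_zero, Nat.cast_eq_zero]
    rcases h with h | h | h <;>
      simp [weight₄, chainWeight, chainTerms, kern, h.not_gt, h.ne']

theorem weight₃_eq {n : ℕ} (i : Fin 3 → Fin n) : (weight₃ i : ℝ) = 6 * orderWeight i := by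
  by_cases hi : Monotone i
  · have h01 : i 0 ≤ i 1 := hi (by decide)
    have h12 : i 1 ≤ i 2 := hi (by decide)
    have key : ∀ b : Fin 3 → ℕ, (∀ x y, i x = i y ↔ b x = b y) → ∀ m w : ℕ,
        (Finset.univ.filter fun τ : Equiv.Perm (Fin 3) => ∀ a, b (τ a) = b a).card = m →
        weight₃ i = w → w * m = 6 → m ≠ 0 → (weight₃ i : ℝ) = 6 * orderWeight i := by
      intro b hb m w hm hw hwm hm0
      rw [orderWeight_of_monotone hi b hb, hm, hw]
      have h1 : (m : ℝ) ≠ 0 := by exact_mod_cast hm0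
      have h2 : (w : ℝ) * m = 6 := by exact_mod_cast hwm
      field_simp
      exact h2
    rw [Fin.le_def] at h01 h12
    rcases h01.eq_or_lt with e1 | e1 <;> rcases h12.eq_or_lt with e2 | e2
    · refine key ![0, 0, 0] ?_ 6 1 (by decide) ?_ (by norm_num) (by norm_num)
      · intro x y; fin_cases x <;> fin_cases y <;> simp [Fin.ext_iff] <;> omega
      · simp [weight₃, chainWeight₃, chainTerms₃, kern, e1, e2]
    · refine key ![0, 0, 1] ?_ 2 3 (by decide) ?_ (by norm_num) (by norm_num)
      · intro x y; fin_cases x <;> fin_cases y <;> simp [Fin.ext_iff] <;> omega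
      · simp [weight₃, chainWeight₃, chainTerms₃, kern, e1, e2]
    · refine key ![0, 1, 1] ?_ 2 3 (by decide) ?_ (by norm_num) (by norm_num)
      · intro x y; fin_cases x <;> fin_cases y <;> simp [Fin.ext_iff] <;> omega
      · have h : (i 0 : ℕ) < i 2 := by omega
        simp [weight₃, chainWeight₃, chainTerms₃, kern, e2, h]
    · refine key ![0, 1, 2] ?_ 1 6 (by decide) ?_ (by norm_num) (by norm_num)
      · intro x y; fin_cases x <;> fin_cases y <;> simp [Fin.ext_iff] <;> omega
      · simp [weight₃, chainWeight₃, chainTerms₃, kern, e1, e2]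
  · have h : (i 1 : ℕ) < i 0 ∨ (i 2 : ℕ) < i 1 := by
      by_contra hcon
      refine hi (Fin.monotone_iff_le_succ.mpr fun a => ?_)
      rw [Fin.le_def]
      fin_cases a <;> simp <;> omega
    rw [orderWeight, if_neg hi, mul_zero, Nat.cast_eq_zero]
    rcases h with h | h <;>
      simp [weight₃, chainWeight₃, chainTerms₃, kern, h.not_gt, h.ne']

theorem chainSum_smul {R : Type*} [CommSemiring R] {k n : ℕ} (c : R) (g : (Fin k → Fin n) → R)
    (σ : Equiv.Perm (Fin k)) (A : Fin n → Fin n → R) :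
    chainSum (fun i => c * g i) σ A = c ^ 2 * chainSum g σ A := by
  simp only [chainSum, Finset.mul_sum]
  exact Finset.sum_congr rfl fun i _ => Finset.sum_congr rfl fun j _ => by ring

/-! ### Rotation by a right angle -/

/-- Reversing both positions and slots preserves monotonicity and conjugates the stabiliser by the
reversal. -/
theorem orderWeight_rev {k n : ℕ} (i : Fin k → Fin n) :
    orderWeight (fun a => (i a.rev).rev) = orderWeight i := by
  classical
  have hmono : Monotone (fun a : Fin k => (i a.rev).rev) ↔ Monotone i := by
    constructor
    · intro h a b hab
      have := h (Fin.rev_le_rev.mpr hab)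
      simpa using this
    · intro h a b hab
      exact Fin.rev_le_rev.mpr (h (Fin.rev_le_rev.mpr hab))
  have hcard : (Finset.univ.filter fun τ : Equiv.Perm (Fin k) =>
        ∀ a, (i (τ a).rev).rev = (i a.rev).rev).card =
      (Finset.univ.filter fun τ : Equiv.Perm (Fin k) => ∀ a, i (τ a) = i a).card := by
    refine Finset.card_equiv (Fin.revPerm.permCongr) fun τ => ?_
    simp only [Finset.mem_filter, Finset.mem_univ, true_and, Fin.rev_inj, Equiv.permCongr_apply]
    constructor
    · intro h a
      have := h a.rev
      simpa using this
    · intro h a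
      have := h a.rev
      simpa using this
  unfold orderWeight
  simp only [hmono]
  split_ifs
  · congr 2
  · rfl

/-- Replacing each factor $A_{ij}$ by $A_{j,\mathrm{rev}\,i}$ exchanges the roles of rows and
columns. Reversing the tuple that has become the columns makes it increasing again, at no cost by
`orderWeight_rev`. -/
theorem chainSum_rotate {k n : ℕ} (σ : Equiv.Perm (Fin k)) (A : Fin n → Fin n → ℝ)
    (hA : ∀ i j, A j i.rev = A i j) :
    chainSum orderWeight (σ.symm.trans Fin.revPerm) A = chainSum orderWeight σ A := by
  have h : chainSum orderWeight σ A = ∑ i : Fin k → Fin n, ∑ j : Fin k → Fin n,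
      orderWeight i * orderWeight j * ∏ b, A (j b) (i (σ.symm b)).rev := by
    refine Finset.sum_congr rfl fun i _ => Finset.sum_congr rfl fun j _ => ?_
    rw [← Equiv.prod_comp σ fun b => A (j b) (i (σ.symm b)).rev]
    simp only [Equiv.symm_apply_apply, hA]
  rw [h, ← Equiv.sum_comp (Fin.revPerm.arrowCongr Fin.revPerm), chainSum, Finset.sum_comm]
  refine Finset.sum_congr rfl fun i _ => Finset.sum_congr rfl fun j _ => ?_
  have : orderWeight (Fin.revPerm.arrowCongr Fin.revPerm i : Fin k → Fin n) = orderWeight i :=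
    orderWeight_rev i
  rw [this]
  simp [Equiv.arrowCongr, mul_comm]

/-! ### The mixture: quarter-turn symmetry, double stochasticity, non-uniformity. -/

theorem mixPerm_sq (c : Fin 3) (i : Fin 32) : mixPerm c (mixPerm c i) = i.rev := by
  have h : ∀ (l : List ℕ) (π : Equiv.Perm (Fin 32)), (∀ i : Fin 32, (π i : ℕ) = l.getD i 0) →
      (∀ i : Fin 32, l.getD (l.getD i 0) 0 = i.rev) → ∀ i, π (π i) = i.rev := by
    intro l π h1 h2 i
    ext
    rw [h1, h1, h2]
  fin_cases c
  · exact h _ _ pi1_val (by decide +kernel) i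
  · exact h _ _ pi2_val (by decide +kernel) i
  · exact h _ _ pi3_val (by decide +kernel) i

theorem mixMatrix_rotate (x y z : ℝ) (i j : Fin 32) :
    mixMatrix x y z j i.rev = mixMatrix x y z i j := by
  rw [mixMatrix_apply, mixMatrix_apply]
  refine Finset.sum_congr rfl fun c _ => ?_
  congr 1
  -- $\pi_c(j)=\mathrm{rev}\,i=\pi_c(\pi_c(i))$ holds exactly when $j=\pi_c(i)$.
  rw [← mixPerm_sq c i, (mixPerm c).injective.eq_iff]
  exact propext ⟨Eq.symm, Eq.symm⟩

theorem mixMatrix_mem_doublyStochastic {x y z : ℝ} (hx : 0 ≤ x) (hy : 0 ≤ y) (hz : 0 ≤ z)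
    (h : x + y + z = 1) : mixMatrix x y z ∈ doublyStochastic ℝ (Fin 32) := by
  have hc := convex_doublyStochastic (R := ℝ) (n := Fin 32)
  have h1 := permMatrix_mem_doublyStochastic (R := ℝ) (σ := pi1)
  have h2 := permMatrix_mem_doublyStochastic (R := ℝ) (σ := pi2)
  have h3 := permMatrix_mem_doublyStochastic (R := ℝ) (σ := pi3)
  have := hc.sum_mem (t := Finset.univ) (w := ![x, y, z])
    (z := ![pi1.permMatrix ℝ, pi2.permMatrix ℝ, pi3.permMatrix ℝ])
    (by intro i _; fin_cases i <;> assumption) (by simpa [Fin.sum_univ_three] using h)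
    (by intro i _; fin_cases i <;> assumption)
  simpa [Fin.sum_univ_three, mixMatrix] using this

/-- None of the three permutations fixes the first point, so the corner cell has mass zero under the
step measure. -/
theorem stepMeasure_mixMatrix_ne_volume (x y z : ℝ) :
    stepMeasure (mixMatrix x y z) ≠ volume := by
  intro h
  have h0 : mixMatrix x y z 0 0 = 0 := by
    have h1 : pi1 0 ≠ 0 := by decide
    have h2 : pi2 0 ≠ 0 := by decide
    have h3 : pi3 0 ≠ 0 := by decide
    simp [mixMatrix_apply, mixEntry, mixPerm, Fin.sum_univ_three, h1, h2, h3]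
  have hvol : (volume : Measure (unitInterval × unitInterval)) (cell (0 : Fin 32) 0) ≠ 0 := by
    rw [cell_eq, Measure.volume_eq_prod, Measure.prod_prod, volume_slot]
    simp
  refine hvol ?_
  rw [← h, stepMeasure_eq, Measure.coe_finsetSum, Finset.sum_apply]
  refine Finset.sum_eq_zero fun c _ => ?_
  rw [Measure.smul_apply, smul_eq_mul, Measure.restrict_apply (measurableSet_cell _ _)]
  by_cases hc : c = (0, 0)
  · rw [hc, h0]; simp
  · have : cell (0 : Fin 32) 0 ∩ cell c.1 c.2 = ∅ := by
      refine Set.eq_empty_iff_forall_notMem.mpr fun p hp => hc ?_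
      obtain ⟨⟨hx, hy⟩, hx', hy'⟩ := hp
      ext1
      · by_contra hne
        exact lt_irrefl _ (lt_of_mem_slot (Fin.pos_of_ne_zero hne) hx hx')
      · by_contra hne
        exact lt_irrefl _ (lt_of_mem_slot (Fin.pos_of_ne_zero hne) hy hy')
    rw [this]; simp

/-! ### A common root of the two forms -/

/-- A case of the Poincaré–Miranda theorem. The values of $s$ over which some zero of $g(s,\cdot)$
has $f\le0$, respectively $f\ge0$, form two nonempty closed sets that cover the connected interval,
so they share a point $s$. Strict monotonicity makes the zero of $g(s,\cdot)$ unique, so $f$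
vanishes there. -/
theorem exists_common_root (f g : ℝ → ℝ → ℝ) (hf : Continuous fun p : ℝ × ℝ => f p.1 p.2)
    (hg : Continuous fun p : ℝ × ℝ => g p.1 p.2)
    (hf0 : ∀ t ∈ Set.Icc (0 : ℝ) 1, f 0 t < 0) (hf1 : ∀ t ∈ Set.Icc (0 : ℝ) 1, 0 < f 1 t)
    (hg0 : ∀ s ∈ Set.Icc (0 : ℝ) 1, g s 0 < 0) (hg1 : ∀ s ∈ Set.Icc (0 : ℝ) 1, 0 < g s 1)
    (hmono : ∀ s ∈ Set.Icc (0 : ℝ) 1, StrictMonoOn (g s) (Set.Icc 0 1)) :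
    ∃ s ∈ Set.Icc (0 : ℝ) 1, ∃ t ∈ Set.Icc (0 : ℝ) 1, f s t = 0 ∧ g s t = 0 := by
  set B : Set (ℝ × ℝ) := Set.Icc 0 1 ×ˢ Set.Icc 0 1
  have hB : IsCompact B := isCompact_Icc.prod isCompact_Icc
  have hex : ∀ s ∈ Set.Icc (0 : ℝ) 1, ∃ t ∈ Set.Icc (0 : ℝ) 1, g s t = 0 := by
    intro s hs
    have hc : ContinuousOn (g s) (Set.Icc 0 1) :=
      (hg.comp (by fun_prop : Continuous fun t : ℝ => (s, t))).continuousOn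
    exact intermediate_value_Icc zero_le_one hc ⟨(hg0 s hs).le, (hg1 s hs).le⟩
  have hclosed : ∀ C : Set (ℝ × ℝ), IsClosed C →
      IsClosed (Prod.fst '' (B ∩ C)) := fun C hC =>
    ((hB.inter_right hC).image continuous_fst).isClosed
  have hcl1 : IsClosed {p : ℝ × ℝ | g p.1 p.2 = 0 ∧ f p.1 p.2 ≤ 0} :=
    (isClosed_eq hg continuous_const).inter (isClosed_le hf continuous_const)
  have hcl2 : IsClosed {p : ℝ × ℝ | g p.1 p.2 = 0 ∧ 0 ≤ f p.1 p.2} :=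
    (isClosed_eq hg continuous_const).inter (isClosed_le continuous_const hf)
  have hconn := isPreconnected_closed_iff.mp (isPreconnected_Icc (a := (0 : ℝ)) (b := 1)) _ _
    (hclosed _ hcl1) (hclosed _ hcl2)
    (by
      intro s hs
      obtain ⟨t, ht, hgt⟩ := hex s hs
      rcases le_total (f s t) 0 with h | h
      · exact Or.inl ⟨(s, t), ⟨⟨hs, ht⟩, hgt, h⟩, rfl⟩
      · exact Or.inr ⟨(s, t), ⟨⟨hs, ht⟩, hgt, h⟩, rfl⟩)
    (by
      have h0 : (0 : ℝ) ∈ Set.Icc (0 : ℝ) 1 := by simp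
      obtain ⟨t, ht, hgt⟩ := hex 0 h0
      exact ⟨0, h0, (0, t), ⟨⟨h0, ht⟩, hgt, (hf0 t ht).le⟩, rfl⟩)
    (by
      have h1 : (1 : ℝ) ∈ Set.Icc (0 : ℝ) 1 := by simp
      obtain ⟨t, ht, hgt⟩ := hex 1 h1
      exact ⟨1, h1, (1, t), ⟨⟨h1, ht⟩, hgt, (hf1 t ht).le⟩, rfl⟩)
  obtain ⟨s, hs, ⟨⟨s₁, t⟩, ⟨⟨_, ht⟩, hgt, hft⟩, h1⟩, ⟨⟨s₂, t'⟩, ⟨⟨_, ht'⟩, hgt', hft'⟩, h2⟩⟩ := hconn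
  simp only at h1 h2 hgt hft hgt' hft' ht ht'
  subst h1 h2
  have : t = t' := (hmono _ hs).injOn ht ht' (hgt.trans hgt'.symm)
  subst this
  exact ⟨_, hs, t, ht, le_antisymm hft hft', hgt⟩

/-- Linear bounds on the increments in $t$ of the monomials $s^it^j$. With these monomials as atoms,
strict monotonicity of a polynomial becomes a problem for `linarith`; `pow_mul_pow_mem` does the
same for signs. -/
theorem pow_diff_bound {s t t' : ℝ} (hs : s ∈ Set.Icc (0 : ℝ) 1) (ht : 0 ≤ t) (htt : t ≤ t')
    (ht' : t' ≤ 1) (i j : ℕ) {c : ℝ} (hc : j = c) :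
    0 ≤ s ^ i * (t' ^ j - t ^ j) ∧ s ^ i * (t' ^ j - t ^ j) ≤ c * (t' - t) := by
  subst hc
  have h0 : 0 ≤ t' ^ j - t ^ j := sub_nonneg.mpr (pow_le_pow_left₀ ht htt j)
  have h1 : t' ^ j - t ^ j ≤ j * (t' - t) := by
    clear h0
    induction j with
    | zero => simp
    | succ j ih =>
      have e : t' ^ (j + 1) - t ^ (j + 1) = t' * (t' ^ j - t ^ j) + t ^ j * (t' - t) := by ring
      have a0 : 0 ≤ t' ^ j - t ^ j := sub_nonneg.mpr (pow_le_pow_left₀ ht htt j)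
      have a1 : t' * (t' ^ j - t ^ j) ≤ 1 * (t' ^ j - t ^ j) := mul_le_mul_of_nonneg_right ht' a0
      have a2 : t ^ j * (t' - t) ≤ 1 * (t' - t) :=
        mul_le_mul_of_nonneg_right (pow_le_one₀ ht (htt.trans ht')) (sub_nonneg.mpr htt)
      rw [e]; push_cast; linarith
  have h2 : s ^ i ≤ 1 := pow_le_one₀ hs.1 hs.2
  exact ⟨mul_nonneg (pow_nonneg hs.1 i) h0, (mul_le_of_le_one_left h0 h2).trans h1⟩

theorem pow_mul_pow_mem {s t : ℝ} (hs : s ∈ Set.Icc (0 : ℝ) 1) (ht : t ∈ Set.Icc (0 : ℝ) 1)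
    (i j : ℕ) : 0 ≤ s ^ i * t ^ j ∧ s ^ i * t ^ j ≤ 1 :=
  ⟨mul_nonneg (pow_nonneg hs.1 i) (pow_nonneg ht.1 j),
    mul_le_one₀ (pow_le_one₀ hs.1 hs.2) (pow_nonneg ht.1 j) (pow_le_one₀ ht.1 ht.2)⟩

noncomputable def q1234 (x y z : ℝ) : ℝ :=
      2766720 * x ^ 4 + 6585088 * x ^ 3 * y + 5580416 * x ^ 2 * y ^ 2 + 2472448 * x * y ^ 3 +
      710400 * y ^ 4 + 7645888 * x ^ 3 * z + 14511488 * x ^ 2 * y * z + 9296192 * x * y ^ 2 * z +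
      2430592 * y ^ 3 * z + 8638880 * x ^ 2 * z ^ 2 + 11955392 * x * y * z ^ 2 +
      4101920 * y ^ 2 * z ^ 2 + 4794688 * x * z ^ 3 + 3416704 * y * z ^ 3 + 1034976 * z ^ 4

noncomputable def q2143 (x y z : ℝ) : ℝ :=
      196736 * x ^ 4 + 1981696 * x ^ 3 * y + 5642368 * x ^ 2 * y ^ 2 + 6126592 * x * y ^ 3 +
      2269184 * y ^ 4 + 1789504 * x ^ 3 * z + 9253504 * x ^ 2 * y * z +
      14888128 * x * y ^ 2 * z + 7424128 * y ^ 3 * z + 4231840 * x ^ 2 * z ^ 2 +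
      12681664 * x * y * z ^ 2 + 9321760 * y ^ 2 * z ^ 2 + 3675328 * x * z ^ 3 +
      5203072 * y * z ^ 3 + 1036256 * z ^ 4

noncomputable def q123 (x y z : ℝ) : ℝ :=
      46832 * x ^ 3 + 109200 * x ^ 2 * y + 87024 * x * y ^ 2 + 24656 * y ^ 3 +
      117408 * x ^ 2 * z + 194208 * x * y * z + 79536 * y ^ 2 * z + 105096 * x * z ^ 2 +
      88176 * y * z ^ 2 + 32936 * z ^ 3

/-- The forms, less their expected values, in coordinates `s, t` on a small square around
the root. -/
noncomputable def gap (q : ℝ → ℝ → ℝ → ℝ) (c s t : ℝ) : ℝ :=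
  q (3 / 40 + s / 100) (1 / 20 + t / 100) (7 / 8 - s / 100 - t / 100) - c

theorem exists_root :
    ∃ s ∈ Set.Icc (0 : ℝ) 1, ∃ t ∈ Set.Icc (0 : ℝ) 1,
      gap q1234 (32 ^ 4) s t = 0 ∧ gap q2143 (32 ^ 4) s t = 0 := by
  obtain ⟨s, hs, t, ht, h1, h2⟩ := exists_common_root
    -- The coefficients approximate, up to scaling of the rows, the inverse of the Jacobian of the
    -- two gaps on the square: the first combination varies mainly with $s$, the second mainly with
    -- $t$.
    (fun s t => 51 * gap q1234 (32 ^ 4) s t + 40 * gap q2143 (32 ^ 4) s t)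
    (fun s t => 34 * gap q1234 (32 ^ 4) s t + 39 * gap q2143 (32 ^ 4) s t)
    (by unfold gap q1234 q2143; fun_prop) (by unfold gap q1234 q2143; fun_prop)
    (fun t ht => by
      simp only [gap, q1234, q2143]
      linarith [(pow_mul_pow_mem ht ht 1 0).1, (pow_mul_pow_mem ht ht 1 0).2,
        (pow_mul_pow_mem ht ht 2 0).1, (pow_mul_pow_mem ht ht 2 0).2,
        (pow_mul_pow_mem ht ht 3 0).1, (pow_mul_pow_mem ht ht 3 0).2,
        (pow_mul_pow_mem ht ht 4 0).1, (pow_mul_pow_mem ht ht 4 0).2])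
    (fun t ht => by
      simp only [gap, q1234, q2143]
      linarith [(pow_mul_pow_mem ht ht 1 0).1, (pow_mul_pow_mem ht ht 1 0).2,
        (pow_mul_pow_mem ht ht 2 0).1, (pow_mul_pow_mem ht ht 2 0).2,
        (pow_mul_pow_mem ht ht 3 0).1, (pow_mul_pow_mem ht ht 3 0).2,
        (pow_mul_pow_mem ht ht 4 0).1, (pow_mul_pow_mem ht ht 4 0).2])
    (fun s hs => by
      simp only [gap, q1234, q2143]
      linarith [(pow_mul_pow_mem hs hs 1 0).1, (pow_mul_pow_mem hs hs 1 0).2,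
        (pow_mul_pow_mem hs hs 2 0).1, (pow_mul_pow_mem hs hs 2 0).2,
        (pow_mul_pow_mem hs hs 3 0).1, (pow_mul_pow_mem hs hs 3 0).2,
        (pow_mul_pow_mem hs hs 4 0).1, (pow_mul_pow_mem hs hs 4 0).2])
    (fun s hs => by
      simp only [gap, q1234, q2143]
      linarith [(pow_mul_pow_mem hs hs 1 0).1, (pow_mul_pow_mem hs hs 1 0).2,
        (pow_mul_pow_mem hs hs 2 0).1, (pow_mul_pow_mem hs hs 2 0).2,
        (pow_mul_pow_mem hs hs 3 0).1, (pow_mul_pow_mem hs hs 3 0).2,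
        (pow_mul_pow_mem hs hs 4 0).1, (pow_mul_pow_mem hs hs 4 0).2])
    (fun s hs t ht t' ht' hlt => by
      have hd := fun i j (c : ℝ) hc =>
        pow_diff_bound hs ht.1 hlt.le ht'.2 i j (c := c) hc
      simp only [gap, q1234, q2143]
      linarith [(hd 0 1 1 (by norm_num)).1, (hd 0 1 1 (by norm_num)).2,
        (hd 0 2 2 (by norm_num)).1, (hd 0 2 2 (by norm_num)).2,
        (hd 0 3 3 (by norm_num)).1, (hd 0 3 3 (by norm_num)).2,
        (hd 0 4 4 (by norm_num)).1, (hd 0 4 4 (by norm_num)).2,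
        (hd 1 1 1 (by norm_num)).1, (hd 1 1 1 (by norm_num)).2,
        (hd 1 2 2 (by norm_num)).1, (hd 1 2 2 (by norm_num)).2,
        (hd 1 3 3 (by norm_num)).1, (hd 1 3 3 (by norm_num)).2,
        (hd 2 1 1 (by norm_num)).1, (hd 2 1 1 (by norm_num)).2,
        (hd 2 2 2 (by norm_num)).1, (hd 2 2 2 (by norm_num)).2,
        (hd 3 1 1 (by norm_num)).1, (hd 3 1 1 (by norm_num)).2])
  -- The combinations are independent ($51\cdot39-40\cdot34=629$), so both gaps vanish.
  exact ⟨s, hs, t, ht, by linarith, by linarith⟩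

theorem gap_q123_pos {s t : ℝ} (hs : s ∈ Set.Icc (0 : ℝ) 1) (ht : t ∈ Set.Icc (0 : ℝ) 1) :
    0 < gap q123 (32 ^ 3) s t := by
  simp only [gap, q123]
  linarith [(pow_mul_pow_mem hs ht 0 1).1, (pow_mul_pow_mem hs ht 0 1).2,
    (pow_mul_pow_mem hs ht 0 2).1, (pow_mul_pow_mem hs ht 0 2).2,
    (pow_mul_pow_mem hs ht 0 3).1, (pow_mul_pow_mem hs ht 0 3).2,
    (pow_mul_pow_mem hs ht 1 0).1, (pow_mul_pow_mem hs ht 1 0).2,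
    (pow_mul_pow_mem hs ht 1 1).1, (pow_mul_pow_mem hs ht 1 1).2,
    (pow_mul_pow_mem hs ht 1 2).1, (pow_mul_pow_mem hs ht 1 2).2,
    (pow_mul_pow_mem hs ht 2 0).1, (pow_mul_pow_mem hs ht 2 0).2,
    (pow_mul_pow_mem hs ht 2 1).1, (pow_mul_pow_mem hs ht 2 1).2,
    (pow_mul_pow_mem hs ht 3 0).1, (pow_mul_pow_mem hs ht 3 0).2]

/-! ### Permutations sampled from a permuton -/

theorem exists_perm_of_range_eq {α : Type*} {k : ℕ} {e e' : Fin k → α}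
    (he : Function.Injective e) (he' : Function.Injective e') (h : Set.range e = Set.range e') :
    ∃ κ : Equiv.Perm (Fin k), ∀ a, e a = e' (κ a) := by
  refine ⟨(Equiv.ofInjective e he).trans ((Equiv.setCongr h).trans
    (Equiv.ofInjective e' he').symm), fun a => ?_⟩
  have := Equiv.apply_ofInjective_symm he' ((Equiv.setCongr h) (Equiv.ofInjective e he a))
  simp only [Equiv.trans_apply]
  rw [this]
  rfl

theorem hasPattern_comp_perm {k : ℕ} (σ κ : Equiv.Perm (Fin k))
    (q : Fin k → unitInterval × unitInterval) :
    HasPattern σ (fun a => q (κ a)) ↔ HasPattern σ q := by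
  constructor
  · rintro ⟨τ, h1, h2⟩
    exact ⟨τ.trans κ, h1, h2⟩
  · rintro ⟨τ, h1, h2⟩
    refine ⟨τ.trans κ.symm, by simpa using h1, by simpa using h2⟩

/-- The points of `p` with index in `S` have pattern `σ`. -/
def HasPatternOn {k n : ℕ} (σ : Equiv.Perm (Fin k)) (p : Fin n → unitInterval × unitInterval)
    (S : Finset (Fin n)) : Prop :=
  ∃ h : S.card = k, HasPattern σ fun a => p (S.orderEmbOfFin h a)

/-- `τ` sorts the points by first coordinate, so positions `S` in `π` correspond to labels `τ '' S`.
Having a pattern does not depend on how those labels are enumerated. -/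
theorem isInducedBy_iff {k n : ℕ} (σ : Equiv.Perm (Fin k))
    (p : Fin n → unitInterval × unitInterval) (τ π : Equiv.Perm (Fin n))
    (hτ : StrictMono fun a => (p (τ a)).1)
    (hπ : ∀ i j, π i < π j ↔ (p (τ i)).2 < (p (τ j)).2) (S : Finset (Fin n)) :
    IsInducedBy σ π S ↔ HasPatternOn σ p (S.map τ.toEmbedding) := by
  have hcard : (S.map τ.toEmbedding).card = S.card := Finset.card_map _
  by_cases hS : S.card = k
  swap
  · exact ⟨fun ⟨h, _⟩ => absurd h hS, fun ⟨h, _⟩ => absurd (hcard ▸ h) hS⟩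
  have hmono : StrictMono fun a => (p (τ (S.orderEmbOfFin hS a))).1 :=
    hτ.comp (S.orderEmbOfFin hS).strictMono
  have h1 : IsInducedBy σ π S ↔ HasPattern σ fun a => p (τ (S.orderEmbOfFin hS a)) := by
    constructor
    · rintro ⟨h, hi⟩
      exact ⟨1, hmono, fun i j => (hi i j).trans (hπ _ _)⟩
    · rintro ⟨τ', hx, hy⟩
      have : τ' = 1 := perm_eq_of_strictMono
        (x := fun a => (p (τ (S.orderEmbOfFin hS a))).1) hx hmono
      subst this
      exact ⟨hS, fun i j => (hy i j).trans (hπ _ _).symm⟩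
  have h2 : HasPatternOn σ p (S.map τ.toEmbedding) ↔
      HasPattern σ fun a => p (τ (S.orderEmbOfFin hS a)) := by
    obtain ⟨κ, hκ⟩ := exists_perm_of_range_eq
      (e := fun a => τ (S.orderEmbOfFin hS a))
      (e' := (S.map τ.toEmbedding).orderEmbOfFin (hcard.trans hS))
      (τ.injective.comp (S.orderEmbOfFin hS).injective)
      (RelEmbedding.injective _)
      (by
        rw [Finset.range_orderEmbOfFin]
        change Set.range (τ ∘ S.orderEmbOfFin hS) = _
        rw [Set.range_comp, Finset.range_orderEmbOfFin]
        simp)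
    simp only [hκ]
    rw [hasPattern_comp_perm σ κ fun a => p ((S.map τ.toEmbedding).orderEmbOfFin _ a)]
    exact ⟨fun ⟨_, h⟩ => h, fun h => ⟨_, h⟩⟩
  rw [h1, h2]

-- One permutation serves all patterns at once, and the count runs over subsets of the original
-- labels, for which events on disjoint subsets are independent under sampling.
open Classical in
theorem exists_perm_density {n : ℕ} (p : Fin n → unitInterval × unitInterval)
    (hx : Function.Injective fun a => (p a).1) (hy : Function.Injective fun a => (p a).2) :
    ∃ π : Equiv.Perm (Fin n), ∀ (k : ℕ) (σ : Equiv.Perm (Fin k)),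
      density σ π = (((Finset.univ : Finset (Fin n)).powersetCard k).filter
        fun S => HasPatternOn σ p S).card / (n.choose k : ℝ) := by
  set τ := Tuple.sort fun a => (p a).1
  have hτ : StrictMono fun a => (p (τ a)).1 :=
    (Tuple.monotone_sort fun a => (p a).1).strictMono_of_injective (hx.comp τ.injective)
  set ρ := Tuple.sort fun a => (p (τ a)).2
  have hρ : StrictMono fun a => (p (τ (ρ a))).2 :=
    (Tuple.monotone_sort fun a => (p (τ a)).2).strictMono_of_injective
      ((hy.comp τ.injective).comp ρ.injective)
  have hπ : ∀ i j, ρ.symm i < ρ.symm j ↔ (p (τ i)).2 < (p (τ j)).2 := by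
    intro i j
    have := hρ.lt_iff_lt (a := ρ.symm i) (b := ρ.symm j)
    simpa using this.symm
  -- `ρ` lists the points, already sorted by first coordinate, in increasing height; its inverse
  -- gives the height ranks, which are the values of the permutation.
  refine ⟨ρ.symm, fun k σ => ?_⟩
  unfold density
  congr 2
  refine Finset.card_bij (fun S _ => S.map τ.toEmbedding) ?_ ?_ ?_
  · intro S hS
    simp only [Finset.mem_filter, Finset.mem_powersetCard, Finset.subset_univ, true_and,
      Finset.card_map] at hS ⊢
    exact ⟨hS.1, (isInducedBy_iff σ p τ ρ.symm hτ hπ S).mp hS.2⟩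
  · intro S _ T _ h
    exact Finset.map_injective _ h
  · intro T hT
    simp only [Finset.mem_filter, Finset.mem_powersetCard, Finset.subset_univ, true_and] at hT
    have hmap : (T.map τ.symm.toEmbedding).map τ.toEmbedding = T := by
      ext a; simp
    refine ⟨T.map τ.symm.toEmbedding, ?_, hmap⟩
    simp only [Finset.mem_filter, Finset.mem_powersetCard, Finset.subset_univ, true_and,
      Finset.card_map]
    refine ⟨hT.1, (isInducedBy_iff σ p τ ρ.symm hτ hπ _).mpr ?_⟩
    rw [hmap]
    exact hT.2

theorem setOf_hasPatternOn {k n : ℕ} (σ : Equiv.Perm (Fin k)) (S : Finset (Fin n))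
    (h : S.card = k) :
    {p | HasPatternOn σ p S} =
      S.restrict ⁻¹' ((fun (q : S → unitInterval × unitInterval) (a : Fin k) =>
        q (S.orderIsoOfFin h a)) ⁻¹' {q | HasPattern σ q}) := by
  ext p
  exact ⟨fun ⟨_, hp⟩ => hp, fun hp => ⟨h, hp⟩⟩

theorem measurableSet_hasPatternOn {k n : ℕ} (σ : Equiv.Perm (Fin k)) (S : Finset (Fin n)) :
    MeasurableSet {p | HasPatternOn σ p S} := by
  by_cases h : S.card = k
  · rw [setOf_hasPatternOn σ S h]
    exact (Finset.measurable_restrict S) ((by fun_prop : Measurable _) (measurableSet_hasPattern σ))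
  · convert MeasurableSet.empty
    ext p
    simp [HasPatternOn, h]

theorem pi_hasPatternOn (μ : Measure (unitInterval × unitInterval)) [IsProbabilityMeasure μ]
    {k n : ℕ} (σ : Equiv.Perm (Fin k)) (S : Finset (Fin n)) (h : S.card = k) :
    (Measure.pi fun _ : Fin n => μ).real {p | HasPatternOn σ p S} = permutonDensity σ μ := by
  have h1 := Measure.map_infinitePi_infinitePi_of_inj (P := fun _ : Fin n => μ)
    (S.orderEmbOfFin h).injective
  rw [Measure.infinitePi_eq_pi, Measure.infinitePi_eq_pi] at h1
  unfold permutonDensity Measure.real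
  rw [← h1, Measure.map_apply (by fun_prop) (measurableSet_hasPattern σ)]
  congr 2
  ext p
  exact ⟨fun ⟨_, hp⟩ => hp, fun hp => ⟨h, hp⟩⟩

theorem pi_hasPatternOn_inter (μ : Measure (unitInterval × unitInterval)) [IsProbabilityMeasure μ]
    {k n : ℕ} (σ : Equiv.Perm (Fin k)) (S T : Finset (Fin n)) (hS : S.card = k) (hT : T.card = k)
    (hST : Disjoint S T) :
    (Measure.pi fun _ : Fin n => μ).real ({p | HasPatternOn σ p S} ∩ {p | HasPatternOn σ p T}) =
      permutonDensity σ μ ^ 2 := by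
  have hind := (ProbabilityTheory.iIndepFun_pi (μ := fun _ : Fin n => μ)
    (X := fun _ => id) fun _ => aemeasurable_id).indepFun_finset S T hST
      (fun i => measurable_pi_apply i)
  have hm : ∀ (U : Finset (Fin n)) (hU : U.card = k),
      MeasurableSet ((fun (q : U → unitInterval × unitInterval) (a : Fin k) =>
        q (U.orderIsoOfFin hU a)) ⁻¹' {q | HasPattern σ q}) := fun U hU =>
    (by fun_prop : Measurable _) (measurableSet_hasPattern σ)
  have h := hind.measure_inter_preimage_eq_mul _ _ (hm S hS) (hm T hT)
  have h' : (Measure.pi fun _ : Fin n => μ)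
      ({p | HasPatternOn σ p S} ∩ {p | HasPatternOn σ p T}) =
      (Measure.pi fun _ : Fin n => μ) {p | HasPatternOn σ p S} *
        (Measure.pi fun _ : Fin n => μ) {p | HasPatternOn σ p T} := by
    rw [setOf_hasPatternOn σ S hS, setOf_hasPatternOn σ T hT]
    exact h
  unfold Measure.real
  rw [h', ENNReal.toReal_mul, sq]
  congr 1
  · exact pi_hasPatternOn μ σ S hS
  · exact pi_hasPatternOn μ σ T hT

/-! ### Concentration of densities -/

-- Second moment method: the mean square is the average over pairs $(S,T)$ of the covariances. These
-- vanish for pairs related by `R` and are at most 1 otherwise, so the fraction of unrelated pairs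
-- bounds it.
open Classical in
theorem integral_sq_sum_indicator_sub_le {Ω ι : Type*} [MeasurableSpace Ω] (P : Measure Ω)
    [IsProbabilityMeasure P] (I : Finset ι) (E : ι → Set Ω) (hE : ∀ S, MeasurableSet (E S))
    (R : ι → ι → Prop) (d b : ℝ) (hd : ∀ S ∈ I, P.real (E S) = d)
    (hR : ∀ S ∈ I, ∀ T ∈ I, R S T → P.real (E S ∩ E T) = d ^ 2)
    (hb : ∀ S ∈ I, ((I.filter fun T => ¬ R S T).card : ℝ) ≤ b * I.card) (hI : 0 < I.card) :
    Integrable (fun ω => (((I.filter fun S => ω ∈ E S).card : ℝ) / I.card - d) ^ 2) P ∧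
      ∫ ω, (((I.filter fun S => ω ∈ E S).card : ℝ) / I.card - d) ^ 2 ∂P ≤ b := by
  have hN : (0 : ℝ) < I.card := by exact_mod_cast hI
  have key : ∀ ω, (((I.filter fun S => ω ∈ E S).card : ℝ) / I.card - d) ^ 2 =
      (∑ S ∈ I, ∑ T ∈ I, ((E S ∩ E T).indicator 1 ω - d * (E S).indicator 1 ω
        - d * (E T).indicator 1 ω + d ^ 2)) / (I.card : ℝ) ^ 2 := by
    intro ω
    have h1 : ((I.filter fun S => ω ∈ E S).card : ℝ) / I.card - d =
        (∑ S ∈ I, ((E S).indicator (1 : Ω → ℝ) ω - d)) / I.card := by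
      rw [Finset.sum_sub_distrib, Finset.sum_const, nsmul_eq_mul, Finset.card_filter]
      simp only [Set.indicator_apply, Pi.one_apply]
      push_cast
      field_simp
    rw [h1, div_pow, sq (∑ S ∈ I, _), Finset.sum_mul_sum]
    congr 1
    refine Finset.sum_congr rfl fun S _ => Finset.sum_congr rfl fun T _ => ?_
    rw [Set.inter_indicator_one]
    simp only [Pi.mul_apply]
    ring
  have hint : ∀ S, Integrable ((E S).indicator (1 : Ω → ℝ)) P := fun S =>
    (integrable_const (1 : ℝ)).indicator (hE S)
  have hint2 : ∀ S T, Integrable ((E S ∩ E T).indicator (1 : Ω → ℝ)) P := fun S T =>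
    (integrable_const (1 : ℝ)).indicator ((hE S).inter (hE T))
  have hterm : ∀ S T, Integrable (fun ω => (E S ∩ E T).indicator (1 : Ω → ℝ) ω
      - d * (E S).indicator 1 ω - d * (E T).indicator 1 ω + d ^ 2) P := fun S T =>
    (((hint2 S T).sub ((hint S).const_mul d)).sub ((hint T).const_mul d)).add
      (integrable_const _)
  simp only [key]
  refine ⟨(integrable_finsetSum _ fun S _ => integrable_finsetSum _ fun T _ =>
    hterm S T).div_const _, ?_⟩
  rw [integral_div, integral_finsetSum _ fun S _ => integrable_finsetSum _ fun T _ => hterm S T]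
  rw [div_le_iff₀ (by positivity)]
  calc _ ≤ ∑ S ∈ I, ∑ T ∈ I, (if ¬ R S T then (1 : ℝ) else 0) := by
        refine Finset.sum_le_sum fun S hS => ?_
        rw [integral_finsetSum _ fun T _ => hterm S T]
        refine Finset.sum_le_sum fun T hT => ?_
        have i1 : Integrable (fun ω => (E S ∩ E T).indicator (1 : Ω → ℝ) ω
            - d * (E S).indicator 1 ω) P := (hint2 S T).sub ((hint S).const_mul d)
        have i2 : Integrable (fun ω => (E S ∩ E T).indicator (1 : Ω → ℝ) ω
            - d * (E S).indicator 1 ω - d * (E T).indicator 1 ω) P :=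
          i1.sub ((hint T).const_mul d)
        have : ∫ ω, ((E S ∩ E T).indicator (1 : Ω → ℝ) ω
            - d * (E S).indicator 1 ω - d * (E T).indicator 1 ω + d ^ 2) ∂P =
            P.real (E S ∩ E T) - d ^ 2 := by
          rw [integral_add i2 (integrable_const _), integral_sub i1 ((hint T).const_mul d),
            integral_sub (hint2 S T) ((hint S).const_mul d), integral_const_mul,
            integral_const_mul, integral_indicator_one (hE S), integral_indicator_one (hE T),
            integral_indicator_one ((hE S).inter (hE T)), hd S hS, hd T hT]
          simp
          ring
        rw [this]
        split_ifs with h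
        · rw [hR S hS T hT h]
          simp
        · have h1 : P.real (E S ∩ E T) ≤ 1 := measureReal_le_one
          nlinarith [sq_nonneg d]
    _ = ∑ S ∈ I, ((I.filter fun T => ¬ R S T).card : ℝ) := by
        refine Finset.sum_congr rfl fun S _ => ?_
        rw [Finset.card_filter]
        push_cast
        rfl
    _ ≤ ∑ S ∈ I, b * I.card := Finset.sum_le_sum hb
    _ = b * (I.card : ℝ) ^ 2 := by rw [Finset.sum_const, nsmul_eq_mul]; ring

theorem card_filter_not_disjoint {k n : ℕ} (S : Finset (Fin n)) (hS : S.card = k)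
    [DecidablePred fun T => ¬ Disjoint S T] :
    (((Finset.univ : Finset (Fin n)).powersetCard k).filter fun T => ¬ Disjoint S T).card =
      n.choose k - (n - k).choose k := by
  have h1 : (((Finset.univ : Finset (Fin n)).powersetCard k).filter fun T => Disjoint S T) =
      Sᶜ.powersetCard k := by
    ext T
    simp only [Finset.mem_filter, Finset.mem_powersetCard, Finset.subset_univ, true_and,
      Finset.subset_compl_iff_disjoint_left]
    tauto
  have h2 := Finset.card_filter_add_card_filter_not
    (s := (Finset.univ : Finset (Fin n)).powersetCard k) (fun T => Disjoint S T)
  rw [h1, Finset.card_powersetCard, Finset.card_powersetCard, Finset.card_compl, Fintype.card_fin,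
    Finset.card_univ, Fintype.card_fin, hS] at h2
  omega

/-- Both binomials are asymptotic to $n^k/k!$: two random $k$-subsets are disjoint with probability
tending to 1. -/
theorem tendsto_choose_sub_div_choose (k : ℕ) :
    Tendsto (fun n : ℕ => (((n - k).choose k : ℕ) : ℝ) / (n.choose k : ℕ)) atTop (𝓝 1) := by
  have h1 := isEquivalent_choose k
  have h2 := h1.comp_tendsto (tendsto_sub_atTop_nat k)
  have h3 := h2.div h1
  refine h3.symm.tendsto_nhds ?_
  have h4 : Tendsto (fun n : ℕ => (((n - k : ℕ) : ℝ) / n) ^ k) atTop (𝓝 1) := by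
    have h5 : Tendsto (fun n : ℕ => 1 - (k : ℝ) / n) atTop (𝓝 (1 - 0)) :=
      tendsto_const_nhds.sub (tendsto_const_div_atTop_nhds_zero_nat (k : ℝ))
    have h6 := h5.pow k
    simp only [sub_zero, one_pow] at h6
    refine h6.congr' ?_
    filter_upwards [eventually_ge_atTop (k + 1)] with n hn
    have : (0 : ℝ) < n := by exact_mod_cast (by omega : 0 < n)
    rw [Nat.cast_sub (by omega)]
    field_simp
  refine h4.congr' ?_
  filter_upwards with n
  have : (k.factorial : ℝ) ≠ 0 := by positivity
  simp only [Pi.div_apply, Function.comp_apply]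
  rw [div_div_div_cancel_right₀ this, div_pow]

open Classical in
theorem integral_sq_density_sub_le (μ : Measure (unitInterval × unitInterval))
    [IsProbabilityMeasure μ] {k n : ℕ} (σ : Equiv.Perm (Fin k)) (hkn : k ≤ n) :
    Integrable (fun p : Fin n → unitInterval × unitInterval =>
      (((((Finset.univ : Finset (Fin n)).powersetCard k).filter
        fun S => HasPatternOn σ p S).card : ℝ) / (n.choose k : ℝ) - permutonDensity σ μ) ^ 2)
      (Measure.pi fun _ => μ) ∧
    ∫ p : Fin n → unitInterval × unitInterval,
      (((((Finset.univ : Finset (Fin n)).powersetCard k).filter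
        fun S => HasPatternOn σ p S).card : ℝ) / (n.choose k : ℝ) - permutonDensity σ μ) ^ 2
      ∂(Measure.pi fun _ => μ) ≤
      1 - (((n - k).choose k : ℕ) : ℝ) / (n.choose k : ℕ) := by
  have hcard : ((Finset.univ : Finset (Fin n)).powersetCard k).card = n.choose k := by simp
  have hpos : 0 < n.choose k := Nat.choose_pos hkn
  have h := integral_sq_sum_indicator_sub_le (Measure.pi fun _ : Fin n => μ)
    ((Finset.univ : Finset (Fin n)).powersetCard k) (fun S => {p | HasPatternOn σ p S})
    (measurableSet_hasPatternOn σ) Disjoint (permutonDensity σ μ)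
    (1 - (((n - k).choose k : ℕ) : ℝ) / (n.choose k : ℕ))
    (fun S hS => pi_hasPatternOn μ σ S (Finset.mem_powersetCard.mp hS).2)
    (fun S hS T hT hST => pi_hasPatternOn_inter μ σ S T (Finset.mem_powersetCard.mp hS).2
      (Finset.mem_powersetCard.mp hT).2 hST)
    (fun S hS => by
      refine (congrArg (Nat.cast (R := ℝ)) (?_ : _ = n.choose k - (n - k).choose k)).trans_le ?_
      · convert card_filter_not_disjoint S (Finset.mem_powersetCard.mp hS).2
      rw [hcard, Nat.cast_sub (Nat.choose_le_choose k (Nat.sub_le n k))]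
      have : (n.choose k : ℝ) ≠ 0 := by exact_mod_cast hpos.ne'
      field_simp
      exact le_rfl)
    (by rw [hcard]; exact hpos)
  rw [hcard] at h
  exact h

/-- A permuton is the limit of a sequence of permutations, at the level of finitely many pattern
densities. -/
theorem exists_tendsto_density (μ : Measure (unitInterval × unitInterval)) (hμ : IsPermuton μ)
    (Z : Finset (Σ k : ℕ, Equiv.Perm (Fin k))) :
    ∃ π : ℕ → Σ n : ℕ, Equiv.Perm (Fin n), Tendsto (fun n => (π n).1) atTop atTop ∧
      ∀ σ ∈ Z, Tendsto (fun n => density σ.2 (π n).2) atTop (𝓝 (permutonDensity σ.2 μ)) := by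
  classical
  have := hμ.isProbabilityMeasure
  set ε : ℕ → ℝ := fun n =>
    ∑ σ ∈ Z, (1 - (((n - σ.1).choose σ.1 : ℕ) : ℝ) / (n.choose σ.1 : ℕ))
  have hε : Tendsto ε atTop (𝓝 0) := by
    have : Tendsto ε atTop (𝓝 (∑ σ ∈ Z, (1 - 1))) :=
      tendsto_finsetSum _ fun σ _ => tendsto_const_nhds.sub (tendsto_choose_sub_div_choose σ.1)
    simpa using this
  have hex : ∀ n, ∃ π : Equiv.Perm (Fin n), (∀ σ ∈ Z, σ.1 ≤ n) →
      ∑ σ ∈ Z, (density σ.2 π - permutonDensity σ.2 μ) ^ 2 ≤ ε n := by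
    intro n
    by_cases hn : ∀ σ ∈ Z, σ.1 ≤ n
    swap
    -- An arbitrary permutation for the finitely many $n$ below the largest pattern size.
    · exact ⟨1, fun h => absurd h hn⟩
    have hnull : ∀ᵐ p ∂(Measure.pi fun _ : Fin n => μ),
        (Function.Injective fun a => (p a).1) ∧ Function.Injective fun a => (p a).2 :=
      (ae_injective_pi μ measurable_fst hμ.map_fst n).and
        (ae_injective_pi μ measurable_snd hμ.map_snd n)
    -- Some sample without ties has total squared deviation at most its mean; summing over the
    -- finite set `Z` handles all patterns with the same sample.
    obtain ⟨p, hp, hle⟩ := exists_notMem_null_le_integral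
      (integrable_finsetSum Z fun σ hσ => (integral_sq_density_sub_le μ σ.2 (hn σ hσ)).1)
      (ae_iff.mp hnull)
    simp only [Set.mem_ofPred_eq, not_not] at hp
    obtain ⟨π, hπ⟩ := exists_perm_density p hp.1 hp.2
    refine ⟨π, fun _ => ?_⟩
    simp only [hπ]
    refine hle.trans ?_
    rw [integral_finsetSum Z fun σ hσ => (integral_sq_density_sub_le μ σ.2 (hn σ hσ)).1]
    exact Finset.sum_le_sum fun σ hσ => (integral_sq_density_sub_le μ σ.2 (hn σ hσ)).2
  choose π hπ using hex
  refine ⟨fun n => ⟨n, π n⟩, tendsto_id, fun σ hσ => ?_⟩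
  have hsq : Tendsto (fun n => (density σ.2 (π n) - permutonDensity σ.2 μ) ^ 2) atTop (𝓝 0) := by
    refine tendsto_of_tendsto_of_tendsto_of_le_of_le' tendsto_const_nhds hε
      (Eventually.of_forall fun n => sq_nonneg _) ?_
    filter_upwards [eventually_ge_atTop (Z.sup Sigma.fst)] with n hn
    refine le_trans ?_ (hπ n fun σ hσ => (Finset.le_sup (f := Sigma.fst) hσ).trans hn)
    exact Finset.single_le_sum
      (f := fun σ : Σ k : ℕ, Equiv.Perm (Fin k) =>
        (density σ.2 (π n) - permutonDensity σ.2 μ) ^ 2) (fun σ _ => sq_nonneg _) hσ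
  have habs : Tendsto (fun n => |density σ.2 (π n) - permutonDensity σ.2 μ|) atTop (𝓝 0) := by
    have := hsq.sqrt
    simpa [Real.sqrt_sq_eq_abs] using this
  have := (tendsto_zero_iff_abs_tendsto_zero _).mpr habs
  exact tendsto_sub_nhds_zero_iff.mp this

/-! ### The counterexample -/

/-- Each of the two order weights carries a factor 24 in the form, so the density is
$\frac{24}{32^4}\cdot\frac{32^4}{24^2}$. -/
theorem permutonDensity_four {x y z : ℝ} (hA : mixMatrix x y z ∈ doublyStochastic ℝ (Fin 32))
    (σ : Equiv.Perm (Fin 4))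
    (h : chainSum (fun i => (weight₄ i : ℝ)) σ (mixMatrix x y z) = 32 ^ 4) :
    permutonDensity σ (stepMeasure (mixMatrix x y z)) = 1 / 24 := by
  rw [permutonDensity_stepMeasure (by norm_num) σ _ hA]
  simp only [weight₄_eq] at h
  have h := (chainSum_smul 24 orderWeight σ (mixMatrix x y z)).symm.trans h
  rw [show chainSum orderWeight σ (mixMatrix x y z) = 32 ^ 4 / 24 ^ 2 by linarith]
  norm_num [Nat.factorial]

theorem permutonDensity_rotate {x y z : ℝ} (hA : mixMatrix x y z ∈ doublyStochastic ℝ (Fin 32))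
    {k : ℕ} (σ : Equiv.Perm (Fin k)) :
    permutonDensity (σ.symm.trans Fin.revPerm) (stepMeasure (mixMatrix x y z)) =
      permutonDensity σ (stepMeasure (mixMatrix x y z)) := by
  rw [permutonDensity_stepMeasure (by norm_num) _ _ hA,
    permutonDensity_stepMeasure (by norm_num) _ _ hA,
    chainSum_rotate σ _ fun i j => mixMatrix_rotate x y z i j]

theorem p4321_eq : p4321 = p1234.symm.trans Fin.revPerm := by
  have h : ∀ a, p4321 (p1234 a) = Fin.rev a := by decide
  ext1 a
  simpa using h (p1234.symm a)

theorem p3412_eq : p3412 = p2143.symm.trans Fin.revPerm := by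
  have h : ∀ a, p3412 (p2143 a) = Fin.rev a := by decide
  ext1 a
  simpa using h (p2143.symm a)

theorem exists_mixMatrix : ∃ x y z : ℝ, 0 ≤ x ∧ 0 ≤ y ∧ 0 ≤ z ∧ x + y + z = 1 ∧
    q1234 x y z = 32 ^ 4 ∧ q2143 x y z = 32 ^ 4 ∧ 32 ^ 3 < q123 x y z := by
  obtain ⟨s, hs, t, ht, h1, h2⟩ := exists_root
  have h3 := gap_q123_pos hs ht
  exact ⟨3 / 40 + s / 100, 1 / 20 + t / 100, 7 / 8 - s / 100 - t / 100, by linarith [hs.1],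
    by linarith [ht.1], by linarith [hs.2, ht.2], by ring, sub_eq_zero.mp h1, sub_eq_zero.mp h2,
    sub_pos.mp h3⟩

theorem one_div_six_lt_permutonDensity {x y z : ℝ}
    (hA : mixMatrix x y z ∈ doublyStochastic ℝ (Fin 32)) (h : 32 ^ 3 < q123 x y z) :
    1 / 6 < permutonDensity (1 : Equiv.Perm (Fin 3)) (stepMeasure (mixMatrix x y z)) := by
  rw [permutonDensity_stepMeasure (by norm_num) _ _ hA]
  have h3 := form123 x y z
  simp only [weight₃_eq] at h3
  have h3 := (chainSum_smul 6 orderWeight 1 (mixMatrix x y z)).symm.trans h3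
  change _ = q123 x y z at h3
  rw [← h3] at h
  norm_num [Nat.factorial] at h ⊢
  linarith

/-- A permuton with the expected densities of the patterns in `Z`, but not of all patterns,
shows that `Z` is not quasirandom-forcing. -/
theorem not_isQuasirandomForcing (μ : Measure (unitInterval × unitInterval)) (hμ : IsPermuton μ)
    (Z : Finset (Σ k : ℕ, Equiv.Perm (Fin k)))
    (hZ : ∀ σ ∈ Z, permutonDensity σ.2 μ = 1 / (σ.1.factorial : ℝ))
    {k : ℕ} (τ : Equiv.Perm (Fin k)) (hτ : permutonDensity τ μ ≠ 1 / (k.factorial : ℝ)) :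
    ¬ IsQuasirandomForcing (Z : Set (Σ k : ℕ, Equiv.Perm (Fin k))) := by
  classical
  intro hforce
  -- With `τ` inserted, its density along the sequence tends to its density in the permuton, while
  -- quasirandomness would force the limit $1/k!$.
  obtain ⟨π, hsize, hπ⟩ := exists_tendsto_density μ hμ (insert ⟨k, τ⟩ Z)
  have hquasi := (hforce π hsize).mpr fun σ hσ => by
    rw [← hZ σ hσ]
    exact hπ σ (Finset.mem_insert_of_mem hσ)
  exact hτ (tendsto_nhds_unique (hπ ⟨k, τ⟩ (Finset.mem_insert_self _ _)) (hquasi k τ))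

end PermQuasi

theorem mainTheorem7 :
    ¬ PermQuasi.IsQuasirandomForcing
        {⟨4, PermQuasi.p1234⟩, ⟨4, PermQuasi.p2143⟩, ⟨4, PermQuasi.p3412⟩, ⟨4, PermQuasi.p4321⟩} ∧
    ∃ x y z : ℝ, 0 ≤ x ∧ 0 ≤ y ∧ 0 ≤ z ∧ x + y + z = 1 ∧
      PermQuasi.mixMatrix x y z ∈ doublyStochastic ℝ (Fin 32) ∧
      PermQuasi.IsPermuton (PermQuasi.stepMeasure (PermQuasi.mixMatrix x y z)) ∧
      PermQuasi.stepMeasure (PermQuasi.mixMatrix x y z) ≠ MeasureTheory.volume ∧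
      PermQuasi.permutonDensity PermQuasi.p1234
        (PermQuasi.stepMeasure (PermQuasi.mixMatrix x y z)) = 1 / 24 ∧
      PermQuasi.permutonDensity PermQuasi.p2143
        (PermQuasi.stepMeasure (PermQuasi.mixMatrix x y z)) = 1 / 24 ∧
      PermQuasi.permutonDensity PermQuasi.p3412
        (PermQuasi.stepMeasure (PermQuasi.mixMatrix x y z)) = 1 / 24 ∧
      PermQuasi.permutonDensity PermQuasi.p4321
        (PermQuasi.stepMeasure (PermQuasi.mixMatrix x y z)) = 1 / 24 := by
  classical
  obtain ⟨x, y, z, hx, hy, hz, h, h1234, h2143, h123⟩ := PermQuasi.exists_mixMatrix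
  have hA := PermQuasi.mixMatrix_mem_doublyStochastic hx hy hz h
  have hμ := PermQuasi.isPermuton_stepMeasure (by norm_num) _ hA
  have d1234 := PermQuasi.permutonDensity_four hA PermQuasi.p1234
    ((PermQuasi.form1234 x y z).trans h1234)
  have d2143 := PermQuasi.permutonDensity_four hA PermQuasi.p2143
    ((PermQuasi.form2143 x y z).trans h2143)
  have d4321 := (PermQuasi.permutonDensity_rotate hA PermQuasi.p1234).trans d1234
  have d3412 := (PermQuasi.permutonDensity_rotate hA PermQuasi.p2143).trans d2143
  rw [← PermQuasi.p4321_eq] at d4321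
  rw [← PermQuasi.p3412_eq] at d3412
  refine ⟨?_, x, y, z, hx, hy, hz, h, hA, hμ, PermQuasi.stepMeasure_mixMatrix_ne_volume x y z,
    d1234, d2143, d3412, d4321⟩
  have hnot := PermQuasi.not_isQuasirandomForcing _ hμ
    {⟨4, PermQuasi.p1234⟩, ⟨4, PermQuasi.p2143⟩, ⟨4, PermQuasi.p3412⟩, ⟨4, PermQuasi.p4321⟩}
    (by
      have h24 : ((Nat.factorial 4 : ℕ) : ℝ) = 24 := by norm_num [Nat.factorial]
      simp only [Finset.mem_insert, Finset.mem_singleton]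
      rintro σ (rfl | rfl | rfl | rfl) <;> simp only [h24] <;> assumption)
    -- The witness against quasirandomness is 123, of density above $1/6$.
    (1 : Equiv.Perm (Fin 3)) (by
      have := PermQuasi.one_div_six_lt_permutonDensity hA h123
      norm_num [Nat.factorial] at this ⊢
      exact this.ne')
  simpa using hnot
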